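/- Let $\mathcal P_n$ be the set of real symmetric positive definite $n\times n$ matrices, let $\beta\in(-\infty,0)\cup(0,1/n)$, and let $\mathcal M_n^\beta$ be $\mathcal P_n$ with the Riemannian metric $$g_X^\beta(U,V)=(\det X)^\beta\bigl(\operatorname{tr}(X^{-1}UX^{-1}V)-\beta\operatorname{tr}(X^{-1}U)\operatorname{tr}(X^{-1}V)\bigr),\qquad U,V \text{ symmetric}.$$ For $M,N\in\mathcal P_n$ let $\delta(M,N)=\bigl(\sum_i\ln^2\mu_i\bigr)^{1/2}$, where $\mu_1,\dots,\mu_n$ are the eigenvalues of $M^{-1}N$, and put $$\gamma_\beta(A,B)=\frac{|\beta|\,\delta\bigl((\det A)^{-1/n}A,(\det B)^{-1/n}B\bigr)}{2\sqrt{1/n-\beta}}.$$ A minimal geodesic from $A$ to $B$ is a $C^2$ curve $P:[0,1]\to\mathcal P_n$ with $P(0)=A$, $P(1)=B$, of constant speed, whose length $\int_0^1\sqrt{g^\beta_{P}(P',P')}\,dt$ is least among all $C^2$ curves $[0,1]\to\mathcal P_n$ from $A$ to $B$. A geodesic from $A$ to $B$ is a $C^2$ curve $P:[0,1]\to\mathcal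 P_n$ with $P(0)=A$, $P(1)=B$ that satisfies the Euler--Lagrange equation of the energy $\frac12\int_0^1 g^\beta_{P}(P',P')\,dt$. Let $D_A,D_B\in\mathcal P_n$ be diagonal matrices with diagonal entries $a_1,\dots,a_n$ and $b_1,\dots,b_n$, let $\gamma=\gamma_\beta(D_A,D_B)$, and suppose that $0<\gamma<\pi$. Put $$\sigma=\det(D_A^{-1}D_B)^{\beta/2},\qquad \zeta_i=\ln\Bigl(\frac{b_i}{a_i}\,\sigma^{-2/(n\beta)}\Bigr)\quad(i=1,\dots,n).$$ Then $\gamma=|\beta|\,\|\zeta\|/(2\sqrt{1/n-\beta})$, where $\|\zeta\|=\bigl(\sum_i\zeta_i^2\bigr)^{1/2}$, and there is a curve $P:[0,1]\to\mathcal P_n$ that is both the unique minimal geodesic and the unique geodesic of $\mathcal M_n^\beta$ from $D_A$ to $D_B$. It is diagonal: for $t\in[0,1]$, $P(t)=\operatorname{diag}(\lambda_1(t),\dots,\lambda_n(t))$ with $$\begin{aligned}\lambda_i(t)=\biggl(&a_i^{n\beta}(1-t)(1-t+t\sigma\cos\gamma)\exp\Bigl(\frac{n\beta}{\gamma}\operatorname{arctan2}(t\sigma\sin\gamma,\;1-t+t\sigma\cos\gamma)\,\zeta_i\Bigr)\\&+b_i^{n\beta}\,t\bigl(t+(1-t)\sigma^{-1}\cos\gamma\bigr)\exp\Bigl(-\frac{n\beta}{\gamma}\operatorname{arctan2}((1-t)\sin\gamma,\;(1-t)\cos\gamma+t\sigma)\,\zeta_i\Bigr)\biggr)^{\frac1{n\beta}},\end{aligned}$$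 where $\operatorname{arctan2}(y,x)\in(-\pi,\pi]$ is the angle of the point with abscissa $x$ and ordinate $y$. -/

import Mathlib

open Set

noncomputable section

namespace PowerGeometry

/-- The metric of `𝓜ₙ^β` at the positive definite matrix `X`:
`(det X) ^ β * (tr (X⁻¹ A X⁻¹ B) - β * tr (X⁻¹ A) * tr (X⁻¹ B))` for symmetric `A`, `B`. -/
def metric {n : ℕ} (β : ℝ) (X A B : Matrix (Fin n) (Fin n) ℝ) : ℝ :=
  X.det ^ β *
    ((X⁻¹ * A * X⁻¹ * B).trace - β * (X⁻¹ * A).trace * (X⁻¹ * B).trace)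

/-- The derivative on `[0,1]` (one-sided at the end points) of a matrix-valued curve,
taken entry by entry. -/
def velocity {n : ℕ} (P : ℝ → Matrix (Fin n) (Fin n) ℝ) (t : ℝ) :
    Matrix (Fin n) (Fin n) ℝ :=
  Matrix.of fun i j => derivWithin (fun s => P s i j) (Icc 0 1) t

/-- `P` restricts to a `C²` curve `[0,1] → 𝒫ₙ` from `A` to `B`. -/
structure IsCurveJoining {n : ℕ} (A B : Matrix (Fin n) (Fin n) ℝ)
    (P : ℝ → Matrix (Fin n) (Fin n) ℝ) : Prop where
  contDiffOn : ∀ i j, ContDiffOn ℝ 2 (fun t => P t i j) (Icc 0 1)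
  posDef : ∀ t ∈ Icc (0 : ℝ) 1, (P t).PosDef
  source : P 0 = A
  target : P 1 = B

/-- The speed of a curve in `𝓜ₙ^β`. -/
def speed {n : ℕ} (β : ℝ) (P : ℝ → Matrix (Fin n) (Fin n) ℝ) (t : ℝ) : ℝ :=
  √(metric β (P t) (velocity P t) (velocity P t))

/-- The length of a curve in `𝓜ₙ^β`. -/
def length {n : ℕ} (β : ℝ) (P : ℝ → Matrix (Fin n) (Fin n) ℝ) : ℝ :=
  ∫ t in (0 : ℝ)..1, speed β P t

/-- A minimal geodesic of `𝓜ₙ^β` from `A` to `B`: a `C²` curve of least length among all the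
`C²` curves from `A` to `B`, parametrized proportionally to arc length. -/
structure IsMinimalGeodesic {n : ℕ} (β : ℝ) (A B : Matrix (Fin n) (Fin n) ℝ)
    (P : ℝ → Matrix (Fin n) (Fin n) ℝ) : Prop where
  joins : IsCurveJoining A B P
  minimal : ∀ Q, IsCurveJoining A B Q → length β P ≤ length β Q
  constantSpeed : ∃ c : ℝ, ∀ t ∈ Icc (0 : ℝ) 1, speed β P t = c

/-- A geodesic of `𝓜ₙ^β` from `A` to `B`: a `C²` curve that satisfies the Euler-Lagrange
equation `d/dt (∂L/∂P') = ∂L/∂P` of the energy, whose Lagrangian is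
`L (P, P') = g_P (P', P') / 2`. The equation is tested against every symmetric direction `V`,
where `∂L/∂P' [V] = g_P (P', V)`. -/
structure IsGeodesic {n : ℕ} (β : ℝ) (A B : Matrix (Fin n) (Fin n) ℝ)
    (P : ℝ → Matrix (Fin n) (Fin n) ℝ) : Prop where
  joins : IsCurveJoining A B P
  eulerLagrange : ∀ V : Matrix (Fin n) (Fin n) ℝ, V.IsSymm → ∀ t ∈ Icc (0 : ℝ) 1,
    HasDerivWithinAt (fun s => metric β (P s) (velocity P s) V)
      (deriv (fun ε : ℝ => metric β (P t + ε • V) (velocity P t) (velocity P t) / 2) 0)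
      (Icc 0 1) t

/-- The affine-invariant distance `(∑ i, (log λᵢ) ^ 2) ^ (1/2)`, where the `λᵢ` are the eigenvalues
of `M⁻¹ N`, counted with multiplicity. -/
def delta {n : ℕ} (M N : Matrix (Fin n) (Fin n) ℝ) : ℝ :=
  √((M⁻¹ * N).charpoly.roots.map fun x => Real.log x ^ 2).sum

/-- `γ_β(A, B) = |β| δ((det A)^(-1/n) A, (det B)^(-1/n) B) / (2 √(1/n - β))`. -/
def gammaBeta {n : ℕ} (β : ℝ) (A B : Matrix (Fin n) (Fin n) ℝ) : ℝ :=
  |β| * delta (A.det ^ (-1 / (n : ℝ)) • A) (B.det ^ (-1 / (n : ℝ)) • B) /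
    (2 * √(1 / (n : ℝ) - β))

/-- The two-argument arctangent: the angle in `(-π, π]` of the point with abscissa `x` and
ordinate `y`. -/
def arctan2 (y x : ℝ) : ℝ := Complex.arg ⟨x, y⟩

/-- `σ = (det (A⁻¹ B)) ^ (β / 2)`. -/
def sigma {n : ℕ} (β : ℝ) (A B : Matrix (Fin n) (Fin n) ℝ) : ℝ :=
  (A⁻¹ * B).det ^ (β / 2)

/-- `ζᵢ = log ((bᵢ / aᵢ) * σ ^ (-2 / (n β)))` for diagonal `A = diag aᵢ` and `B = diag bᵢ`. -/
def zeta {n : ℕ} (β : ℝ) (A B : Matrix (Fin n) (Fin n) ℝ) (i : Fin n) : ℝ :=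
  Real.log (B i i / A i i * sigma β A B ^ (-2 / (n * β)))

/-- The diagonal entries of the geodesic from the diagonal matrix `A` to the diagonal
matrix `B`. -/
def lam {n : ℕ} (β : ℝ) (A B : Matrix (Fin n) (Fin n) ℝ) (i : Fin n) (t : ℝ) : ℝ :=
  let γ := gammaBeta β A B
  let σ := sigma β A B
  let ζ := zeta β A B i
  (A i i ^ (n * β) * ((1 - t) * (1 - t + t * σ * Real.cos γ)) *
      Real.exp (n * β / γ * arctan2 (t * σ * Real.sin γ) (1 - t + t * σ * Real.cos γ) * ζ) +
    B i i ^ (n * β) * (t * (t + (1 - t) * σ⁻¹ * Real.cos γ)) *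
      Real.exp (-(n * β / γ) *
        arctan2 ((1 - t) * Real.sin γ) ((1 - t) * Real.cos γ + t * σ) * ζ)) ^ (1 / (n * β))

end PowerGeometry

end

/-!
The function `s = (det X) ^ β` is positive on `𝒫ₙ`, and with the radius `r = √s` the metric of
`𝓜ₙ^β` is the metric of a cone over the matrices of determinant one: up to a constant factor it is
`dr² + r² dφ²`, where `φ` is the affine-invariant arc length times `|β| / (2 √(1 / n - β))`.
A two-dimensional subcone spanned by the radial direction and a direction `ζ` of diagonal matrices
is flat. Developing it into `ℂ` by `exp` of a log-polar coordinate sends `DA` to `1` (after scaling)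
and `DB` to `σ exp (i γ)`; since `γ < π`, the segment between these points avoids the cut
`(-∞, 0]`, and it is the development of the geodesic `coneGeodesic`. Its entries, computed with
`Complex.log`, give the formula for `lam` (`coneGeodesic_eq_lam`).

*Minimality.* A positive definite `X` has the pivots `dₖ` of the decomposition `X = L D Lᵀ` with `L`
unipotent lower triangular, and `X ↦ diag d` does not increase the metric: the gradients of the
functions `log dₖ` are orthonormal for the trace form, so this is Bessel's inequality
(`sum_sq_trace_rankOnePart_le`). Since it fixes the diagonal end points, and since `log d` can be
projected orthogonally onto the plane spanned by `(1, …, 1)` and `ζ`, every curve from `DA` to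
`DB` is mapped to a plane curve from `1` to `σ exp (i γ)` that is no longer, up to the constant
factor (`ConeData.metric_eq`, `ConeData.chord_le_length`). For a minimal geodesic all the
inequalities are equalities at every time: its development is the segment traversed at constant
speed, and the factor `L` does not move, so that the curve is diagonal
(`ConeData.eqOn_of_isMinimalGeodesic`).

*Geodesics.* For a solution `X` of the Euler-Lagrange equation, invariance under `X ↦ g X gᵀ` with
`det g = ±1` makes the traceless part `C` of `s X' X⁻¹` constant (`IsGeodesic.charge_eq`), and the
trace part yields `2 s s'' = s'² + K tr C²` with a constant `K`. The first fact makes `X` a multiple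
of `exp (τ C) DA` with `τ' = 1 / s`; at the end point, uniqueness of symmetric logarithms forces
`C` to be a multiple of `diag ζ` (`ConeData.charge_eq_diagonal`). The second one then says that the
development of `X` has no acceleration, so that it is the segment again
(`ConeData.eqOn_of_isGeodesic`).
-/

open Set

noncomputable section

namespace PowerGeometry

open scoped Matrix

/-! ### Scalar ordinary differential equations on the unit interval -/

theorem eq_of_hasDerivWithinAt_zero {E : Type*} [NormedAddCommGroup E] [NormedSpace ℝ E]
    {f : ℝ → E} (hf : ∀ t ∈ Icc (0 : ℝ) 1, HasDerivWithinAt f 0 (Icc 0 1) t)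
    {t : ℝ} (ht : t ∈ Icc (0 : ℝ) 1) : f t = f 0 := by
  refine constant_of_derivWithin_zero (fun s hs => (hf s hs).differentiableWithinAt) ?_ t ht
  intro s hs
  exact (hf s (Ico_subset_Icc_self hs)).derivWithin
    (uniqueDiffOn_Icc one_pos s (Ico_subset_Icc_self hs))

theorem sub_eq_of_hasDerivWithinAt_eq {E : Type*} [NormedAddCommGroup E] [NormedSpace ℝ E]
    {f g h : ℝ → E} (hf : ∀ t ∈ Icc (0 : ℝ) 1, HasDerivWithinAt f (h t) (Icc 0 1) t)
    (hg : ∀ t ∈ Icc (0 : ℝ) 1, HasDerivWithinAt g (h t) (Icc 0 1) t)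
    {t : ℝ} (ht : t ∈ Icc (0 : ℝ) 1) : f t - f 0 = g t - g 0 := by
  have := eq_of_hasDerivWithinAt_zero (f := fun s => f s - g s)
    (fun s hs => ((hf s hs).fun_sub (hg s hs)).congr_deriv (sub_self _)) ht
  rw [sub_eq_sub_iff_sub_eq_sub]
  exact this

theorem eq_mul_exp_of_hasDerivWithinAt {f g g' : ℝ → ℝ}
    (hf : ∀ t ∈ Icc (0 : ℝ) 1, HasDerivWithinAt f (g' t * f t) (Icc 0 1) t)
    (hg : ∀ t ∈ Icc (0 : ℝ) 1, HasDerivWithinAt g (g' t) (Icc 0 1) t)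
    {t : ℝ} (ht : t ∈ Icc (0 : ℝ) 1) : f t = f 0 * Real.exp (g t - g 0) := by
  have h := eq_of_hasDerivWithinAt_zero (f := fun s => f s * Real.exp (-g s))
    (fun s hs => by
      have := (hf s hs).mul ((hg s hs).neg.exp)
      refine this.congr_deriv ?_
      simp only [Pi.neg_apply]
      ring) ht
  calc f t = f t * Real.exp (-g t) * Real.exp (g t) := by
        rw [mul_assoc, ← Real.exp_add, neg_add_cancel, Real.exp_zero, mul_one]
    _ = _ := by rw [h, mul_assoc, ← Real.exp_add]; ring_nf

/-! ### Entrywise calculus of matrix-valued curves -/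

/-- The curve `X` of matrices has derivative `V` at `t` within `S`, entry by entry. Stating this
without a norm on matrices keeps it in the form in which `velocity` is defined. -/
def HasEntryDeriv {n : ℕ} (X : ℝ → Matrix (Fin n) (Fin n) ℝ) (V : Matrix (Fin n) (Fin n) ℝ)
    (S : Set ℝ) (t : ℝ) : Prop :=
  ∀ i j, HasDerivWithinAt (fun s => X s i j) (V i j) S t

variable {n : ℕ} {X Y : ℝ → Matrix (Fin n) (Fin n) ℝ} {V W : Matrix (Fin n) (Fin n) ℝ}
  {S : Set ℝ} {t : ℝ}

theorem HasEntryDeriv.const (M : Matrix (Fin n) (Fin n) ℝ) :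
    HasEntryDeriv (fun _ => M) 0 S t := fun i j => hasDerivWithinAt_const t S (M i j)

theorem HasEntryDeriv.add (hX : HasEntryDeriv X V S t) (hY : HasEntryDeriv Y W S t) :
    HasEntryDeriv (fun s => X s + Y s) (V + W) S t := fun i j => (hX i j).add (hY i j)

theorem HasEntryDeriv.sub (hX : HasEntryDeriv X V S t) (hY : HasEntryDeriv Y W S t) :
    HasEntryDeriv (fun s => X s - Y s) (V - W) S t := fun i j => (hX i j).sub (hY i j)

theorem HasEntryDeriv.smul {f : ℝ → ℝ} {f' : ℝ} (hf : HasDerivWithinAt f f' S t)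
    (hX : HasEntryDeriv X V S t) :
    HasEntryDeriv (fun s => f s • X s) (f' • X t + f t • V) S t := fun i j => hf.mul (hX i j)

theorem HasEntryDeriv.mul (hX : HasEntryDeriv X V S t) (hY : HasEntryDeriv Y W S t) :
    HasEntryDeriv (fun s => X s * Y s) (V * Y t + X t * W) S t := by
  intro i j
  simp only [Matrix.mul_apply, Matrix.add_apply, ← Finset.sum_add_distrib]
  exact HasDerivWithinAt.fun_sum fun k _ => (hX i k).mul (hY k j)

theorem HasEntryDeriv.trace (hX : HasEntryDeriv X V S t) :
    HasDerivWithinAt (fun s => (X s).trace) V.trace S t := by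
  simp only [Matrix.trace]
  exact HasDerivWithinAt.fun_sum fun k _ => hX k k

/-- Jacobi's formula. -/
theorem HasEntryDeriv.det (hX : HasEntryDeriv X V S t) :
    HasDerivWithinAt (fun s => (X s).det) ((X t).adjugate * V).trace S t := by
  have h : HasDerivWithinAt (fun s => (X s).det)
      (∑ σ : Equiv.Perm (Fin n), (Equiv.Perm.sign σ : ℝ) *
        ∑ i, (∏ j ∈ Finset.univ.erase i, X t (σ j) j) • V (σ i) i) S t := by
    simp only [Matrix.det_apply']
    exact HasDerivWithinAt.fun_sum fun σ _ =>
      (HasDerivWithinAt.fun_finsetProd fun i _ => hX (σ i) i).const_mul _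
  refine h.congr_deriv ?_
  have h1 : ∀ i, ((X t).adjugate * V) i i = ((X t).updateCol i (fun k => V k i)).det := by
    intro i
    rw [← Matrix.cramer_apply, Matrix.cramer_eq_adjugate_mulVec]
    rfl
  simp only [Matrix.trace, Matrix.diag_apply, h1, Matrix.det_apply', Finset.mul_sum]
  rw [Finset.sum_comm]
  refine Finset.sum_congr rfl fun i _ => Finset.sum_congr rfl fun σ _ => ?_
  rw [← Finset.mul_prod_erase Finset.univ _ (Finset.mem_univ i), Matrix.updateCol_self,
    smul_eq_mul, mul_comm (V _ _)]
  congr 2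
  refine Finset.prod_congr rfl fun j hj => ?_
  rw [Matrix.updateCol_ne (Finset.ne_of_mem_erase hj)]

theorem HasEntryDeriv.updateRow (hX : HasEntryDeriv X V S t) (i : Fin n) (b : Fin n → ℝ) :
    HasEntryDeriv (fun s => (X s).updateRow i b) (V.updateRow i 0) S t := by
  intro k j
  rcases eq_or_ne k i with rfl | h
  · simpa using hasDerivWithinAt_const t S (b j)
  · simpa [Matrix.updateRow_ne h] using hX k j

theorem HasEntryDeriv.inv (hX : HasEntryDeriv X V S t) (h : (X t).det ≠ 0) :
    HasEntryDeriv (fun s => (X s)⁻¹) (-((X t)⁻¹ * V * (X t)⁻¹)) S t := by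
  -- The inverse is differentiable by Cramer's rule; since `Y = 2 Y - Y X Y` for `Y = X⁻¹`,
  -- the unknown derivative of `Y` cancels on the right-hand side.
  have hD : ∃ D, HasEntryDeriv (fun s => (X s)⁻¹) D S t := by
    have : ∀ i j, ∃ d, HasDerivWithinAt (fun s => (X s)⁻¹ i j) d S t := by
      intro i j
      simp only [Matrix.inv_def, Matrix.smul_apply, Ring.inverse_eq_inv', smul_eq_mul,
        Matrix.adjugate_apply]
      exact ⟨_, (hX.det.inv h).mul (hX.updateRow j _).det⟩
    choose D hD using this
    exact ⟨Matrix.of D, hD⟩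
  obtain ⟨D, hD⟩ := hD
  have hev : ∀ᶠ s in nhdsWithin t S, (X s).det ≠ 0 :=
    hX.det.continuousWithinAt.eventually_ne h
  have hu : IsUnit (X t).det := isUnit_iff_ne_zero.2 h
  have key := (hD.add hD).sub ((hD.mul hX).mul hD)
  intro i j
  refine ((key i j).congr_of_eventuallyEq ?_ ?_).congr_deriv ?_
  · filter_upwards [hev] with s hs
    rw [Matrix.nonsing_inv_mul _ (isUnit_iff_ne_zero.2 hs)]
    simp
  · simp only [Matrix.nonsing_inv_mul _ hu]
    simp
  · have : ((D * X t + (X t)⁻¹ * V) * (X t)⁻¹) = D + (X t)⁻¹ * V * (X t)⁻¹ := by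
      rw [add_mul, Matrix.mul_nonsing_inv_cancel_right _ _ hu]
    rw [this, Matrix.nonsing_inv_mul _ hu]
    simp

theorem HasEntryDeriv.det_rpow (hX : HasEntryDeriv X V S t) (h : 0 < (X t).det) (β : ℝ) :
    HasDerivWithinAt (fun s => (X s).det ^ β) (β * (X t).det ^ β * ((X t)⁻¹ * V).trace) S t := by
  refine (hX.det.rpow_const (p := β) (Or.inl h.ne')).congr_deriv ?_
  rw [Matrix.inv_def, Real.rpow_sub_one h.ne', Ring.inverse_eq_inv', Matrix.smul_mul,
    Matrix.trace_smul, smul_eq_mul]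
  field_simp

theorem HasEntryDeriv.log_det (hX : HasEntryDeriv X V S t) (h : 0 < (X t).det) :
    HasDerivWithinAt (fun s => Real.log (X s).det) ((X t)⁻¹ * V).trace S t := by
  refine (hX.det.log h.ne').congr_deriv ?_
  rw [Matrix.inv_def, Ring.inverse_eq_inv', Matrix.smul_mul, Matrix.trace_smul, smul_eq_mul]
  field_simp

/-- The derivative of the metric in the base point, for fixed tangent vectors. -/
theorem HasEntryDeriv.metric (hX : HasEntryDeriv X V S t) (h : 0 < (X t).det) (β : ℝ)
    (U T : Matrix (Fin n) (Fin n) ℝ) :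
    HasDerivWithinAt (fun s => metric β (X s) U T)
      (β * (X t).det ^ β * ((X t)⁻¹ * V).trace *
          (((X t)⁻¹ * U * (X t)⁻¹ * T).trace - β * ((X t)⁻¹ * U).trace * ((X t)⁻¹ * T).trace) -
        (X t).det ^ β *
          (((X t)⁻¹ * V * (X t)⁻¹ * U * (X t)⁻¹ * T).trace +
            ((X t)⁻¹ * U * (X t)⁻¹ * V * (X t)⁻¹ * T).trace -
            β * ((X t)⁻¹ * V * (X t)⁻¹ * U).trace * ((X t)⁻¹ * T).trace -
            β * ((X t)⁻¹ * U).trace * ((X t)⁻¹ * V * (X t)⁻¹ * T).trace)) S t := by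
  have hY := hX.inv h.ne'
  have hYU := hY.mul (HasEntryDeriv.const U)
  have hYT := hY.mul (HasEntryDeriv.const T)
  have h1 := ((hYU.mul hY).mul (HasEntryDeriv.const T)).trace
  have h2 := (hX.det_rpow h β).mul (h1.sub ((hYU.trace.const_mul β).mul hYT.trace))
  refine h2.congr_deriv ?_
  simp only [mul_zero, add_zero, neg_mul, add_mul, Matrix.trace_add,
    Matrix.trace_neg, mul_neg, ← mul_assoc,
    Pi.sub_apply, Pi.mul_apply]
  ring

/-! ### The trace form of a positive definite matrix -/

section TraceForm

variable {n : ℕ} {X D : Matrix (Fin n) (Fin n) ℝ}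

open scoped MatrixOrder in
/-- In the basis that turns `X` into the identity, `tr (D X D X)` is a squared Frobenius norm. -/
theorem exists_trace_eq_trace_transpose_mul_self (hX : X.PosDef) (hD : D.IsSymm) :
    ∃ B : Matrix (Fin n) (Fin n) ℝ, IsUnit B ∧
      (D * X * D * X).trace =
        ((B * D * B.transpose).conjTranspose * (B * D * B.transpose)).trace := by
  obtain ⟨B, hB, rfl⟩ := CStarAlgebra.isStrictlyPositive_iff_eq_star_mul_self.mp
    hX.isStrictlyPositive
  refine ⟨B, hB, ?_⟩
  simp only [Matrix.star_eq_conjTranspose, Matrix.conjTranspose_eq_transpose_of_trivial,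
    Matrix.transpose_mul, Matrix.transpose_transpose, hD.eq, ← mul_assoc]
  rw [Matrix.trace_mul_comm]
  simp only [← mul_assoc]

theorem trace_form_nonneg (hX : X.PosDef) (hD : D.IsSymm) : 0 ≤ (D * X * D * X).trace := by
  obtain ⟨B, -, h⟩ := exists_trace_eq_trace_transpose_mul_self hX hD
  rw [h]
  exact (Matrix.posSemidef_conjTranspose_mul_self _).trace_nonneg

theorem eq_zero_of_trace_form_eq_zero (hX : X.PosDef) (hD : D.IsSymm)
    (h0 : (D * X * D * X).trace = 0) : D = 0 := by
  obtain ⟨B, hB, h⟩ := exists_trace_eq_trace_transpose_mul_self hX hD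
  rw [h, Matrix.trace_conjTranspose_mul_self_eq_zero_iff] at h0
  have hBt : IsUnit B.transpose := (Matrix.isUnit_transpose B).2 hB
  rwa [hBt.mul_left_eq_zero, hB.mul_right_eq_zero] at h0

end TraceForm

/-! ### Leading blocks and the projection onto diagonal matrices -/

/-- The orthogonal projection onto the first `k` coordinates. -/
def headProj (n k : ℕ) : Matrix (Fin n) (Fin n) ℝ :=
  Matrix.diagonal fun i => if (i : ℕ) < k then 1 else 0

/-- The leading `k × k` block of `X`, completed by an identity block to an `n × n` matrix, so that
its determinant is the `k`-th leading principal minor of `X`. -/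
def headBlock {n : ℕ} (k : ℕ) (X : Matrix (Fin n) (Fin n) ℝ) : Matrix (Fin n) (Fin n) ℝ :=
  headProj n k * X * headProj n k + (1 - headProj n k)

/-- The inverse of the leading `k × k` block of `X`, extended by zero to an `n × n` matrix. -/
def headInv {n : ℕ} (k : ℕ) (X : Matrix (Fin n) (Fin n) ℝ) : Matrix (Fin n) (Fin n) ℝ :=
  headProj n k * (headBlock k X)⁻¹

/-- The increment from one inverse leading block to the next. If `X = L D Lᵀ` with `L` unipotent
lower triangular and `D = diag d`, this is the rank-one matrix `w wᵀ / dₖ`, where `w` is the `k`-th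
column of `L⁻ᵀ`. It is also the gradient of `log dₖ` at `X`. -/
def rankOnePart {n : ℕ} (k : Fin n) (X : Matrix (Fin n) (Fin n) ℝ) : Matrix (Fin n) (Fin n) ℝ :=
  headInv (k + 1) X - headInv k X

/-- The logarithm of the `k`-th pivot of `X`, i.e. of the quotient of consecutive leading principal
minors. -/
def logPivot {n : ℕ} (k : Fin n) (X : Matrix (Fin n) (Fin n) ℝ) : ℝ :=
  Real.log (headBlock (k + 1) X).det - Real.log (headBlock k X).det

section HeadBlock

variable {n : ℕ} {X V : Matrix (Fin n) (Fin n) ℝ} (j k : ℕ)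

theorem headProj_mul_headProj : headProj n j * headProj n k = headProj n (min j k) := by
  simp only [headProj, Matrix.diagonal_mul_diagonal, Matrix.diagonal_eq_diagonal_iff]
  intro i
  split_ifs <;> simp <;> omega

theorem headProj_mul_self : headProj n k * headProj n k = headProj n k := by
  rw [headProj_mul_headProj, min_self]

theorem headProj_zero : headProj n 0 = 0 := by simp [headProj]

theorem headProj_self : headProj n n = 1 := by simp [headProj]

theorem headProj_transpose : (headProj n k).transpose = headProj n k := by simp [headProj]

theorem headProj_mul_headBlock :
    headProj n k * headBlock k X = headProj n k * X * headProj n k := by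
  simp [headBlock, mul_add, mul_sub, ← mul_assoc, headProj_mul_self]

theorem headBlock_mul_headProj :
    headBlock k X * headProj n k = headProj n k * X * headProj n k := by
  simp [headBlock, add_mul, sub_mul, mul_assoc, headProj_mul_self]

theorem headBlock_zero : headBlock 0 X = 1 := by simp [headBlock, headProj_zero]

theorem headBlock_self : headBlock n X = X := by simp [headBlock, headProj_self]

theorem posDef_headBlock (hX : X.PosDef) : (headBlock k X).PosDef := by
  have hsymm : X.transpose = X := by
    simpa [Matrix.conjTranspose_eq_transpose_of_trivial] using hX.isHermitian.eq
  refine Matrix.PosDef.of_dotProduct_mulVec_pos ?_ fun x hx => ?_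
  · simp [Matrix.IsHermitian, headBlock, Matrix.conjTranspose_eq_transpose_of_trivial,
      Matrix.transpose_mul, headProj_transpose, hsymm, mul_assoc]
  have h1 : star x ⬝ᵥ headBlock k X *ᵥ x =
      star (headProj n k *ᵥ x) ⬝ᵥ X *ᵥ (headProj n k *ᵥ x) +
        star ((1 - headProj n k) *ᵥ x) ⬝ᵥ ((1 - headProj n k) *ᵥ x) := by
    have e : (1 - headProj n k) = (1 - headProj n k) * (1 - headProj n k) := by
      simp [mul_sub, sub_mul, headProj_mul_self]
    have et : (1 - headProj n k).transpose = 1 - headProj n k := by simp [headProj_transpose]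
    rw [headBlock, Matrix.add_mulVec, dotProduct_add]
    congr 1
    · rw [Matrix.star_mulVec, Matrix.conjTranspose_eq_transpose_of_trivial, headProj_transpose,
        ← Matrix.dotProduct_mulVec, ← Matrix.mulVec_mulVec, ← Matrix.mulVec_mulVec]
    · rw [Matrix.star_mulVec, Matrix.conjTranspose_eq_transpose_of_trivial, et,
        ← Matrix.dotProduct_mulVec, Matrix.mulVec_mulVec, ← e]
  rw [h1]
  by_cases h : headProj n k *ᵥ x = 0
  · have : (1 - headProj n k) *ᵥ x = x := by simp [Matrix.sub_mulVec, h]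
    rw [h, this]
    simpa using Matrix.dotProduct_star_self_pos_iff.2 hx
  · exact add_pos_of_pos_of_nonneg (hX.dotProduct_mulVec_pos h) (dotProduct_star_self_nonneg _)

theorem isUnit_det_headBlock (hX : X.PosDef) : IsUnit (headBlock k X).det :=
  isUnit_iff_ne_zero.2 (posDef_headBlock k hX).det_pos.ne'

theorem headInv_eq_inv_mul (hX : X.PosDef) :
    headInv k X = (headBlock k X)⁻¹ * headProj n k := by
  have hu := isUnit_det_headBlock k hX
  calc headInv k X
      = (headBlock k X)⁻¹ * (headBlock k X * headProj n k) * (headBlock k X)⁻¹ := by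
        rw [← mul_assoc, Matrix.nonsing_inv_mul _ hu, one_mul, headInv]
    _ = (headBlock k X)⁻¹ * headProj n k := by
        rw [headBlock_mul_headProj, ← headProj_mul_headBlock, ← mul_assoc,
          Matrix.mul_nonsing_inv_cancel_right _ _ hu]

theorem headProj_mul_headInv : headProj n k * headInv k X = headInv k X := by
  rw [headInv, ← mul_assoc, headProj_mul_self]

theorem headInv_mul_headProj (hX : X.PosDef) : headInv k X * headProj n k = headInv k X := by
  rw [headInv_eq_inv_mul k hX, mul_assoc, headProj_mul_self]

theorem headInv_transpose (hX : X.PosDef) : (headInv k X).transpose = headInv k X := by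
  have h := (posDef_headBlock k hX).isHermitian.eq
  rw [Matrix.conjTranspose_eq_transpose_of_trivial] at h
  rw [headInv, Matrix.transpose_mul, Matrix.transpose_nonsing_inv, h, headProj_transpose,
    ← headInv_eq_inv_mul k hX, headInv]

theorem headInv_mul_mul_headProj (hX : X.PosDef) :
    headInv k X * X * headProj n k = headProj n k := by
  have hu := isUnit_det_headBlock k hX
  rw [headInv_eq_inv_mul k hX, mul_assoc, mul_assoc, ← mul_assoc (headProj n k),
    ← headBlock_mul_headProj, ← mul_assoc, Matrix.nonsing_inv_mul _ hu, one_mul]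

theorem headProj_mul_mul_headInv (hX : X.PosDef) :
    headProj n k * X * headInv k X = headProj n k := by
  have hu := isUnit_det_headBlock k hX
  rw [headInv, ← mul_assoc, ← headProj_mul_headBlock, mul_assoc, Matrix.mul_nonsing_inv _ hu,
    mul_one]

theorem headInv_mul_mul_headInv (hX : X.PosDef) :
    headInv j X * X * headInv k X = headInv (min j k) X := by
  rcases le_total j k with h | h
  · rw [min_eq_left h]
    calc headInv j X * X * headInv k X
        = headInv j X * headProj n j * X * headInv k X := by rw [headInv_mul_headProj j hX]
      _ = headInv j X * (headProj n j * headProj n k) * X * headInv k X := by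
          rw [headProj_mul_headProj, min_eq_left h]
      _ = headInv j X * headProj n j * (headProj n k * X * headInv k X) := by
          simp only [mul_assoc]
      _ = headInv j X * (headProj n j * headProj n k) := by
          rw [headProj_mul_mul_headInv k hX, mul_assoc]
      _ = headInv j X := by
          rw [headProj_mul_headProj, min_eq_left h, headInv_mul_headProj j hX]
  · rw [min_eq_right h]
    calc headInv j X * X * headInv k X
        = headInv j X * X * (headProj n k * headInv k X) := by rw [headProj_mul_headInv]
      _ = headInv j X * X * ((headProj n j * headProj n k) * headInv k X) := by
          rw [headProj_mul_headProj, min_eq_right h]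
      _ = (headInv j X * X * headProj n j) * headProj n k * headInv k X := by
          simp only [mul_assoc]
      _ = (headProj n j * headProj n k) * headInv k X := by rw [headInv_mul_mul_headProj j hX]
      _ = headInv k X := by
          rw [headProj_mul_headProj, min_eq_right h, headProj_mul_headInv]

theorem trace_headInv_mul (hX : X.PosDef) :
    (headInv k X * X).trace = (headProj n k).trace := by
  rw [← headProj_mul_headInv, mul_assoc, Matrix.trace_mul_comm, headInv_mul_mul_headProj k hX]

theorem headInv_zero : headInv 0 X = 0 := by simp [headInv, headProj_zero]

theorem headInv_self : headInv n X = X⁻¹ := by simp [headInv, headProj_self, headBlock_self]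

end HeadBlock

section RankOnePart

variable {n : ℕ} {X V : Matrix (Fin n) (Fin n) ℝ}

theorem rankOnePart_isSymm (hX : X.PosDef) (i : Fin n) : (rankOnePart i X).IsSymm := by
  rw [Matrix.IsSymm, rankOnePart, Matrix.transpose_sub, headInv_transpose _ hX,
    headInv_transpose _ hX]

theorem rankOnePart_mul_mul (hX : X.PosDef) (i j : Fin n) :
    rankOnePart i X * X * rankOnePart j X = if i = j then rankOnePart i X else 0 := by
  simp only [rankOnePart, sub_mul, mul_sub, headInv_mul_mul_headInv _ _ hX]
  split_ifs with h
  · subst h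
    simp
  · rcases lt_or_gt_of_ne (Fin.val_ne_of_ne h) with h | h
    · rw [min_eq_left (by omega), min_eq_left (by omega), min_eq_left (by omega),
        min_eq_left (by omega)]
      abel
    · rw [min_eq_right (by omega), min_eq_right (by omega), min_eq_right (by omega),
        min_eq_right (by omega)]
      abel

theorem headInv_mul_mul_rankOnePart (hX : X.PosDef) (k : ℕ) (i : Fin n) :
    headInv k X * X * rankOnePart i X = if (i : ℕ) < k then rankOnePart i X else 0 := by
  simp only [rankOnePart, mul_sub, headInv_mul_mul_headInv _ _ hX]
  split_ifs with h
  · rw [min_eq_right (by omega), min_eq_right (by omega)]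
  · rw [min_eq_left (by omega), min_eq_left (by omega), sub_self]

theorem trace_rankOnePart_mul (hX : X.PosDef) (i : Fin n) : (rankOnePart i X * X).trace = 1 := by
  rw [rankOnePart, sub_mul, Matrix.trace_sub, trace_headInv_mul _ hX, trace_headInv_mul _ hX,
    ← Matrix.trace_sub]
  simp only [headProj, Matrix.diagonal_sub, Matrix.trace_diagonal]
  rw [Finset.sum_eq_single i]
  · simp
  · intro j _ hj
    have := Fin.val_ne_of_ne hj
    split_ifs <;> first | omega | simp
  · simp

theorem sum_rankOnePart (X : Matrix (Fin n) (Fin n) ℝ) : ∑ i, rankOnePart i X = X⁻¹ := by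
  have := Finset.sum_range_sub (fun k => headInv k X) n
  rw [← Fin.sum_univ_eq_sum_range (fun k => headInv (k + 1) X - headInv k X), headInv_zero,
    headInv_self, sub_zero] at this
  exact this

theorem sum_logPivot (X : Matrix (Fin n) (Fin n) ℝ) : ∑ i, logPivot i X = Real.log X.det := by
  have := Finset.sum_range_sub (fun k => Real.log (headBlock k X).det) n
  rw [← Fin.sum_univ_eq_sum_range
    (fun k => Real.log (headBlock (k + 1) X).det - Real.log (headBlock k X).det), headBlock_zero,
    headBlock_self, Matrix.det_one, Real.log_one, sub_zero] at this
  exact this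

/-- The defect in Bessel's inequality for the rank-one parts of `X`, which are orthonormal for the
trace form. -/
theorem trace_form_defect (hX : X.PosDef) (V : Matrix (Fin n) (Fin n) ℝ) :
    ((X⁻¹ * V * X⁻¹ - ∑ i, (rankOnePart i X * V).trace • rankOnePart i X) * X *
      (X⁻¹ * V * X⁻¹ - ∑ i, (rankOnePart i X * V).trace • rankOnePart i X) * X).trace =
      (X⁻¹ * V * X⁻¹ * V).trace - ∑ i, (rankOnePart i X * V).trace ^ 2 := by
  have hu : IsUnit X.det := isUnit_iff_ne_zero.2 hX.det_pos.ne'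
  set v := fun i => (rankOnePart i X * V).trace with hv
  set T := ∑ i, v i • rankOnePart i X with hT
  have h1 : (T * V).trace = ∑ i, v i ^ 2 := by
    simp only [hT, Finset.sum_mul, Matrix.trace_sum, Matrix.smul_mul, Matrix.trace_smul, hv,
      smul_eq_mul, sq]
  have h2 : (T * X * T * X).trace = ∑ i, v i ^ 2 := by
    have : T * X * T = ∑ i, v i ^ 2 • rankOnePart i X := by
      simp only [hT, Finset.sum_mul, Finset.mul_sum, Matrix.smul_mul, Matrix.mul_smul,
        rankOnePart_mul_mul hX, smul_ite, smul_zero, Finset.sum_ite_eq',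
        Finset.mem_univ, if_true, smul_smul, sq]
    rw [this, Finset.sum_mul, Matrix.trace_sum]
    refine Finset.sum_congr rfl fun i _ => ?_
    rw [Matrix.smul_mul, Matrix.trace_smul, trace_rankOnePart_mul hX, smul_eq_mul, mul_one]
  have e1 : X⁻¹ * V * X⁻¹ * X = X⁻¹ * V := Matrix.nonsing_inv_mul_cancel_right _ _ hu
  have e2 : T * X * (X⁻¹ * V * X⁻¹) * X = T * V := by
    rw [mul_assoc, e1, mul_assoc, Matrix.mul_nonsing_inv_cancel_left _ _ hu]
  have e3 : (X⁻¹ * V * T * X).trace = (T * V).trace := by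
    rw [Matrix.trace_mul_comm, ← mul_assoc, ← mul_assoc, Matrix.mul_nonsing_inv _ hu, one_mul,
      Matrix.trace_mul_comm]
  rw [sub_mul, sub_mul, mul_sub, mul_sub, sub_mul, sub_mul, sub_mul, Matrix.trace_sub,
    Matrix.trace_sub, Matrix.trace_sub, e2, e1, e3, mul_assoc (X⁻¹ * V), e1, ← mul_assoc, h1, h2]
  ring

theorem trace_form_defect_isSymm (hX : X.PosDef) (hV : V.IsSymm) :
    (X⁻¹ * V * X⁻¹ - ∑ i, (rankOnePart i X * V).trace • rankOnePart i X).IsSymm := by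
  have hX' := hX.isHermitian.eq
  rw [Matrix.conjTranspose_eq_transpose_of_trivial] at hX'
  rw [Matrix.IsSymm, Matrix.transpose_sub, Matrix.transpose_sum]
  simp only [Matrix.transpose_mul, Matrix.transpose_smul, (rankOnePart_isSymm hX _).eq,
    Matrix.transpose_nonsing_inv, hX', hV.eq, mul_assoc]

/-- The projection of a positive definite matrix onto its pivots does not increase the trace
norm of tangent vectors. -/
theorem sum_sq_trace_rankOnePart_le (hX : X.PosDef) (hV : V.IsSymm) :
    ∑ i, (rankOnePart i X * V).trace ^ 2 ≤ (X⁻¹ * V * X⁻¹ * V).trace := by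
  have := trace_form_nonneg hX (trace_form_defect_isSymm hX hV)
  rw [trace_form_defect hX] at this
  linarith

theorem eq_sum_of_trace_form_eq (hX : X.PosDef) (hV : V.IsSymm)
    (h : ∑ i, (rankOnePart i X * V).trace ^ 2 = (X⁻¹ * V * X⁻¹ * V).trace) :
    V = ∑ i, (rankOnePart i X * V).trace • (X * rankOnePart i X * X) := by
  have hu : IsUnit X.det := isUnit_iff_ne_zero.2 hX.det_pos.ne'
  have h0 := eq_zero_of_trace_form_eq_zero hX (trace_form_defect_isSymm hX hV)
    (by rw [trace_form_defect hX, h, sub_self])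
  calc V = X * (X⁻¹ * V * X⁻¹) * X := by
        rw [mul_assoc, Matrix.nonsing_inv_mul_cancel_right _ _ hu,
          Matrix.mul_nonsing_inv_cancel_left _ _ hu]
    _ = _ := by
        rw [sub_eq_zero.1 h0, Finset.mul_sum, Finset.sum_mul]
        simp

theorem headInv_mul_mul_headInv_of_trace_form_eq (hX : X.PosDef) (hV : V.IsSymm)
    (h : ∑ i, (rankOnePart i X * V).trace ^ 2 = (X⁻¹ * V * X⁻¹ * V).trace) (k : ℕ) :
    headInv k X * V * headInv k X =
      ∑ i : Fin n, if (i : ℕ) < k then (rankOnePart i X * V).trace • rankOnePart i X else 0 := by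
  conv_lhs => rw [eq_sum_of_trace_form_eq hX hV h]
  rw [Finset.mul_sum, Finset.sum_mul]
  refine Finset.sum_congr rfl fun i _ => ?_
  have h1 := headInv_mul_mul_rankOnePart hX k i
  have h2 : rankOnePart i X * X * headInv k X = if (i : ℕ) < k then rankOnePart i X else 0 := by
    have := congrArg Matrix.transpose h1
    have hX' := hX.isHermitian.eq
    rw [Matrix.conjTranspose_eq_transpose_of_trivial] at hX'
    rw [Matrix.transpose_mul, Matrix.transpose_mul, headInv_transpose k hX, hX',
      (rankOnePart_isSymm hX i).eq, ← mul_assoc] at this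
    rw [this]
    split_ifs
    · exact rankOnePart_isSymm hX i
    · simp
  rw [Matrix.mul_smul, Matrix.smul_mul, ← mul_assoc, ← mul_assoc, h1]
  split_ifs with hik
  · rw [h2, if_pos hik]
  · simp

/-- On a tangent vector for which the projection onto the pivots is isometric, the rank-one parts
only get rescaled. -/
theorem rankOnePart_variation (hX : X.PosDef) (hV : V.IsSymm)
    (h : ∑ i, (rankOnePart i X * V).trace ^ 2 = (X⁻¹ * V * X⁻¹ * V).trace) (k : Fin n) :
    headInv (k + 1) X * V * headInv (k + 1) X - headInv k X * V * headInv k X =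
      (rankOnePart k X * V).trace • rankOnePart k X := by
  rw [headInv_mul_mul_headInv_of_trace_form_eq hX hV h,
    headInv_mul_mul_headInv_of_trace_form_eq hX hV h, ← Finset.sum_sub_distrib,
    Finset.sum_eq_single k]
  · simp
  · intro j _ hj
    have := Fin.val_ne_of_ne hj
    split_ifs <;> first | omega | simp
  · simp

end RankOnePart

section Curves

variable {n : ℕ} {X : ℝ → Matrix (Fin n) (Fin n) ℝ} {V : Matrix (Fin n) (Fin n) ℝ}
  {S : Set ℝ} {t : ℝ}

theorem HasEntryDeriv.headBlock (hX : HasEntryDeriv X V S t) (k : ℕ) :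
    HasEntryDeriv (fun s => headBlock k (X s)) (headProj n k * V * headProj n k) S t := by
  have := (((HasEntryDeriv.const (S := S) (t := t) (headProj n k)).mul hX).mul
    (HasEntryDeriv.const (headProj n k))).add (HasEntryDeriv.const (1 - headProj n k))
  simpa [PowerGeometry.headBlock] using this

theorem HasEntryDeriv.headInv (hX : HasEntryDeriv X V S t) (h : (X t).PosDef) (k : ℕ) :
    HasEntryDeriv (fun s => headInv k (X s)) (-(headInv k (X t) * V * headInv k (X t))) S t := by
  have := (HasEntryDeriv.const (S := S) (t := t) (headProj n k)).mul
    ((hX.headBlock k).inv (posDef_headBlock k h).det_pos.ne')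
  have e : PowerGeometry.headInv k (X t) * V * PowerGeometry.headInv k (X t) =
      headProj n k * ((PowerGeometry.headBlock k (X t))⁻¹ * (headProj n k * V * headProj n k) *
        (PowerGeometry.headBlock k (X t))⁻¹) := by
    calc _ = headProj n k * ((PowerGeometry.headBlock k (X t))⁻¹ * headProj n k) * V *
          (headProj n k * (PowerGeometry.headBlock k (X t))⁻¹) := by
          rw [← headInv_eq_inv_mul k h, headProj_mul_headInv, ← PowerGeometry.headInv]
      _ = _ := by simp only [mul_assoc]
  rw [zero_mul, zero_add, mul_neg, ← e] at this
  exact this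

theorem HasEntryDeriv.logPivot (hX : HasEntryDeriv X V S t) (h : (X t).PosDef) (k : Fin n) :
    HasDerivWithinAt (fun s => logPivot k (X s)) (rankOnePart k (X t) * V).trace S t := by
  have key : ∀ j : ℕ, HasDerivWithinAt (fun s => Real.log (PowerGeometry.headBlock j (X s)).det)
      (PowerGeometry.headInv j (X t) * V).trace S t := by
    intro j
    refine ((hX.headBlock j).log_det (posDef_headBlock j h).det_pos).congr_deriv ?_
    rw [← mul_assoc, Matrix.trace_mul_comm, ← mul_assoc, ← mul_assoc, ← PowerGeometry.headInv,
      headInv_mul_headProj j h]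
  refine ((key (k + 1)).sub (key k)).congr_deriv ?_
  rw [rankOnePart, sub_mul, Matrix.trace_sub]

theorem HasEntryDeriv.rankOnePart (hX : HasEntryDeriv X V S t) (h : (X t).PosDef) (k : Fin n) :
    HasEntryDeriv (fun s => rankOnePart k (X s))
      (-(PowerGeometry.headInv (k + 1) (X t) * V * PowerGeometry.headInv (k + 1) (X t) -
        PowerGeometry.headInv k (X t) * V * PowerGeometry.headInv k (X t))) S t := by
  have := (hX.headInv h (k + 1)).sub (hX.headInv h k)
  rw [neg_sub_neg] at this
  rwa [neg_sub]

end Curves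

section Diagonal

variable {n : ℕ} {a : Fin n → ℝ}

theorem headBlock_diagonal (k : ℕ) :
    headBlock k (Matrix.diagonal a) = Matrix.diagonal fun i : Fin n => if (i : ℕ) < k then a i else 1 := by
  rw [headBlock, headProj, ← Matrix.diagonal_one, Matrix.diagonal_mul_diagonal,
    Matrix.diagonal_mul_diagonal, Matrix.diagonal_sub, Matrix.diagonal_add,
    Matrix.diagonal_eq_diagonal_iff]
  intro i
  split_ifs <;> simp

theorem inv_diagonal (ha : ∀ i, a i ≠ 0) :
    (Matrix.diagonal a)⁻¹ = Matrix.diagonal fun i => (a i)⁻¹ := by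
  refine Matrix.inv_eq_left_inv ?_
  rw [Matrix.diagonal_mul_diagonal, ← Matrix.diagonal_one, Matrix.diagonal_eq_diagonal_iff]
  exact fun i => inv_mul_cancel₀ (ha i)

theorem logPivot_diagonal (ha : ∀ i, 0 < a i) (k : Fin n) :
    logPivot k (Matrix.diagonal a) = Real.log (a k) := by
  have h : ∀ (j : ℕ) (i : Fin n), (if (i : ℕ) < j then a i else 1) ≠ 0 := by
    intro j i
    split_ifs
    exacts [(ha i).ne', one_ne_zero]
  rw [logPivot, headBlock_diagonal, headBlock_diagonal, Matrix.det_diagonal, Matrix.det_diagonal,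
    Real.log_prod fun i _ => h _ i, Real.log_prod fun i _ => h _ i, ← Finset.sum_sub_distrib,
    Finset.sum_eq_single k]
  · simp
  · intro j _ hj
    have := Fin.val_ne_of_ne hj
    split_ifs <;> first | omega | simp
  · simp

theorem rankOnePart_diagonal (ha : ∀ i, 0 < a i) (k : Fin n) :
    rankOnePart k (Matrix.diagonal a) = Matrix.diagonal (Pi.single k (a k)⁻¹) := by
  have h : ∀ (j : ℕ) (i : Fin n), (if (i : ℕ) < j then a i else 1) ≠ 0 := by
    intro j i
    split_ifs
    exacts [(ha i).ne', one_ne_zero]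
  rw [rankOnePart, headInv, headInv, headBlock_diagonal, headBlock_diagonal, inv_diagonal (h _),
    inv_diagonal (h _), headProj, headProj, Matrix.diagonal_mul_diagonal,
    Matrix.diagonal_mul_diagonal, Matrix.diagonal_sub, Matrix.diagonal_eq_diagonal_iff]
  intro i
  rcases eq_or_ne i k with rfl | hi
  · simp
  · have := Fin.val_ne_of_ne hi
    rw [Pi.single_eq_of_ne hi]
    split_ifs <;> first | omega | simp

end Diagonal

/-! ### Curves of positive definite matrices -/

section Curves

variable {n : ℕ} {A B : Matrix (Fin n) (Fin n) ℝ} {P Q : ℝ → Matrix (Fin n) (Fin n) ℝ}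

theorem HasEntryDeriv.velocity_eq {V : Matrix (Fin n) (Fin n) ℝ} {t : ℝ}
    (h : HasEntryDeriv P V (Icc 0 1) t) (ht : t ∈ Icc (0 : ℝ) 1) : velocity P t = V := by
  ext i j
  exact (h i j).derivWithin (uniqueDiffOn_Icc one_pos t ht)

theorem IsCurveJoining.hasEntryDeriv (h : IsCurveJoining A B Q) {t : ℝ}
    (ht : t ∈ Icc (0 : ℝ) 1) : HasEntryDeriv Q (velocity Q t) (Icc 0 1) t := fun i j =>
  (((h.contDiffOn i j).differentiableOn two_ne_zero) t ht).hasDerivWithinAt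

theorem IsCurveJoining.continuousOn_velocity (h : IsCurveJoining A B Q) (i j : Fin n) :
    ContinuousOn (fun t => velocity Q t i j) (Icc 0 1) :=
  (h.contDiffOn i j).continuousOn_derivWithin (uniqueDiffOn_Icc one_pos) one_le_two

theorem IsCurveJoining.isSymm (h : IsCurveJoining A B Q) {t : ℝ} (ht : t ∈ Icc (0 : ℝ) 1) :
    (Q t).IsSymm := by
  have := (h.posDef t ht).isHermitian.eq
  rwa [Matrix.conjTranspose_eq_transpose_of_trivial] at this

theorem IsCurveJoining.velocity_isSymm (h : IsCurveJoining A B Q) {t : ℝ}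
    (ht : t ∈ Icc (0 : ℝ) 1) : (velocity Q t).IsSymm := by
  ext i j
  exact derivWithin_congr (fun s hs => (h.isSymm hs).apply i j) ((h.isSymm ht).apply i j)

theorem IsCurveJoining.det_pos (h : IsCurveJoining A B Q) {t : ℝ} (ht : t ∈ Icc (0 : ℝ) 1) :
    0 < (Q t).det := (h.posDef t ht).det_pos

theorem IsCurveJoining.continuousOn_speed (h : IsCurveJoining A B Q) (β : ℝ) :
    ContinuousOn (speed β Q) (Icc 0 1) := by
  have hd : ContinuousOn (fun t => (Q t).det ^ β) (Icc 0 1) := fun t ht =>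
    ((h.hasEntryDeriv ht).det_rpow (h.det_pos ht) β).continuousWithinAt
  have hi : ∀ i j, ContinuousOn (fun t => (Q t)⁻¹ i j) (Icc 0 1) := fun i j t ht =>
    ((h.hasEntryDeriv ht).inv (h.det_pos ht).ne' i j).continuousWithinAt
  have hv := h.continuousOn_velocity
  have hm : ∀ i j, ContinuousOn (fun t => ((Q t)⁻¹ * velocity Q t) i j) (Icc 0 1) := by
    intro i j
    simp only [Matrix.mul_apply]
    exact continuousOn_finsetSum _ fun k _ => (hi i k).mul (hv k j)
  have ht : ContinuousOn (fun t => ((Q t)⁻¹ * velocity Q t).trace) (Icc 0 1) := by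
    simp only [Matrix.trace, Matrix.diag_apply]
    exact continuousOn_finsetSum _ fun k _ => hm k k
  have hq : ContinuousOn
      (fun t => ((Q t)⁻¹ * velocity Q t * (Q t)⁻¹ * velocity Q t).trace) (Icc 0 1) := by
    simp only [mul_assoc _ (Q _)⁻¹]
    simp only [Matrix.trace, Matrix.diag_apply, Matrix.mul_apply (M := (Q _)⁻¹ * velocity Q _)]
    exact continuousOn_finsetSum _ fun k _ => continuousOn_finsetSum _ fun l _ =>
      (hm k l).mul (hm l k)
  exact (hd.mul (hq.sub ((continuousOn_const.mul ht).mul ht))).sqrt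

/-- The differential of the metric in the base point, i.e. the right-hand side of the
Euler-Lagrange equation. -/
theorem deriv_metric_add_smul {X : Matrix (Fin n) (Fin n) ℝ} (hX : 0 < X.det) (β : ℝ)
    (U V : Matrix (Fin n) (Fin n) ℝ) :
    deriv (fun ε : ℝ => metric β (X + ε • V) U U / 2) 0 =
      X.det ^ β * (β / 2 * (X⁻¹ * V).trace *
          ((X⁻¹ * U * X⁻¹ * U).trace - β * (X⁻¹ * U).trace * (X⁻¹ * U).trace) -
        (X⁻¹ * V * X⁻¹ * U * X⁻¹ * U).trace +
        β * (X⁻¹ * U).trace * (X⁻¹ * V * X⁻¹ * U).trace) := by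
  have h : HasEntryDeriv (fun ε : ℝ => X + ε • V) V univ 0 := by
    intro i j
    rw [hasDerivWithinAt_univ]
    simpa using ((hasDerivAt_id (0 : ℝ)).mul_const (V i j)).const_add (X i j)
  have h0 : X + (0 : ℝ) • V = X := by simp
  have h1 := h.metric (by rwa [h0]) β U U
  rw [h0, hasDerivWithinAt_univ] at h1
  have h2 : (X⁻¹ * U * X⁻¹ * V * X⁻¹ * U).trace = (X⁻¹ * V * X⁻¹ * U * X⁻¹ * U).trace := by
    rw [mul_assoc (X⁻¹ * U * X⁻¹ * V), mul_assoc (X⁻¹ * U), mul_assoc (X⁻¹ * U),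
      Matrix.trace_mul_comm]
    simp only [mul_assoc]
  rw [(h1.div_const 2).deriv, h2]
  ring

end Curves

/-! ### The flat cone of diagonal matrices -/

/-- The logarithms of the diagonal entries of the point of the two-dimensional cone
through `diag a` in the direction `ζ` that has the log-polar coordinate `w`:
`exp (Re w)` is the radius, relative to that of `diag a`, and `Im w` is the angle. -/
def coneExponent {n : ℕ} (β γ : ℝ) (a ζ : Fin n → ℝ) (w : ℂ) (i : Fin n) : ℝ :=
  Real.log (a i) + 2 / (n * β) * w.re + w.im * (ζ i / γ)

/-- The diagonal matrix with log-polar coordinate `w` on the cone through `diag a` in the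
direction `ζ`. -/
def coneMatrix {n : ℕ} (β γ : ℝ) (a ζ : Fin n → ℝ) (w : ℂ) : Matrix (Fin n) (Fin n) ℝ :=
  Matrix.diagonal fun i => Real.exp (coneExponent β γ a ζ w i)

/-- The straight segment from `1` to `σ exp (i γ)`: the geodesic in the developed cone, scaled so
that it starts at `1`. -/
def coneSegment (σ γ t : ℝ) : ℂ := 1 + t * (σ * Complex.exp (γ * Complex.I) - 1)

/-- The relations between the diagonals `a`, `b` of the end points and the parameters `ζ`, `σ`, `γ`
that occur in the developed cone. -/
structure ConeData (n : ℕ) (β σ γ : ℝ) (a b ζ : Fin n → ℝ) : Prop where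
  n_pos : 0 < n
  β_ne : β ≠ 0
  β_lt : β < 1 / n
  a_pos : ∀ i, 0 < a i
  b_pos : ∀ i, 0 < b i
  σ_pos : 0 < σ
  γ_mem : γ ∈ Ioo 0 Real.pi
  sum_ζ : ∑ i, ζ i = 0
  log_b : ∀ i, Real.log (b i) = Real.log (a i) + 2 / (n * β) * Real.log σ + ζ i
  sum_ζ_sq : ∑ i, ζ i ^ 2 = 4 * (1 / n - β) / β ^ 2 * γ ^ 2

theorem hasDerivWithinAt_re {w : ℝ → ℂ} {w' : ℂ} {S : Set ℝ} {t : ℝ}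
    (h : HasDerivWithinAt w w' S t) : HasDerivWithinAt (fun s => (w s).re) w'.re S t :=
  Complex.reCLM.hasFDerivAt.comp_hasDerivWithinAt t h

theorem hasDerivWithinAt_im {w : ℝ → ℂ} {w' : ℂ} {S : Set ℝ} {t : ℝ}
    (h : HasDerivWithinAt w w' S t) : HasDerivWithinAt (fun s => (w s).im) w'.im S t :=
  Complex.imCLM.hasFDerivAt.comp_hasDerivWithinAt t h

section Segment

variable {σ γ t : ℝ}

theorem coneSegment_re : (coneSegment σ γ t).re = 1 - t + t * σ * Real.cos γ := by
  simp [coneSegment, Complex.exp_ofReal_mul_I_re, Complex.exp_ofReal_mul_I_im]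
  ring

theorem coneSegment_im : (coneSegment σ γ t).im = t * σ * Real.sin γ := by
  simp [coneSegment, Complex.exp_ofReal_mul_I_re, Complex.exp_ofReal_mul_I_im]
  ring

theorem coneSegment_zero : coneSegment σ γ 0 = 1 := by simp [coneSegment]

theorem coneSegment_one : coneSegment σ γ 1 = σ * Complex.exp (γ * Complex.I) := by
  simp [coneSegment]

theorem hasDerivAt_coneSegment (σ γ t : ℝ) :
    HasDerivAt (coneSegment σ γ) (σ * Complex.exp (γ * Complex.I) - 1) t := by
  have h := ((hasDerivAt_id t).ofReal_comp.mul_const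
    (σ * Complex.exp (γ * Complex.I) - 1)).const_add 1
  refine h.congr_deriv ?_
  simp

theorem contDiff_coneSegment (σ γ : ℝ) : ContDiff ℝ 2 (coneSegment σ γ) :=
  contDiff_const.add (Complex.ofRealCLM.contDiff.mul contDiff_const)

theorem coneSegment_mem_slitPlane (hσ : 0 < σ) (hγ : γ ∈ Ioo 0 Real.pi)
    (ht : t ∈ Icc (0 : ℝ) 1) : coneSegment σ γ t ∈ Complex.slitPlane := by
  rcases ht.1.eq_or_lt with rfl | h
  · rw [coneSegment_zero]
    exact Complex.one_mem_slitPlane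
  · refine Complex.mem_slitPlane_iff.2 (Or.inr ?_)
    rw [coneSegment_im]
    exact (mul_pos (mul_pos h hσ) (Real.sin_pos_of_mem_Ioo hγ)).ne'

/-- A continuously lifted logarithm of the segment that starts at `0` is the principal one. -/
theorem eq_log_coneSegment (hσ : 0 < σ) (hγ : γ ∈ Ioo 0 Real.pi) {w w' : ℝ → ℂ}
    (hw : ∀ s ∈ Icc (0 : ℝ) 1, HasDerivWithinAt w (w' s) (Icc 0 1) s) (h0 : w 0 = 0)
    (hexp : ∀ s ∈ Icc (0 : ℝ) 1, Complex.exp (w s) = coneSegment σ γ s)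
    (ht : t ∈ Icc (0 : ℝ) 1) : w t = Complex.log (coneSegment σ γ t) := by
  have h := sub_eq_of_hasDerivWithinAt_eq (f := w)
    (g := fun s => Complex.log (coneSegment σ γ s)) hw (fun s hs => by
      have hne := Complex.slitPlane_ne_zero (coneSegment_mem_slitPlane hσ hγ hs)
      refine ((hasDerivAt_coneSegment σ γ s).hasDerivWithinAt.clog_real
        (coneSegment_mem_slitPlane hσ hγ hs)).congr_deriv ?_
      have h1 : HasDerivWithinAt (coneSegment σ γ) (Complex.exp (w s) * w' s) (Icc 0 1) s :=
        (hw s hs).cexp.congr (fun r hr => (hexp r hr).symm) (hexp s hs).symm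
      rw [(uniqueDiffOn_Icc one_pos s hs).eq_deriv _
        (hasDerivAt_coneSegment σ γ s).hasDerivWithinAt h1, hexp s hs,
        mul_div_cancel_left₀ _ hne]) ht
  simpa [h0, coneSegment_zero] using h

end Segment

section ConeMatrix

variable {n : ℕ} {β σ γ : ℝ} {a b ζ : Fin n → ℝ}

theorem coneMatrix_posDef (w : ℂ) : (coneMatrix β γ a ζ w).PosDef :=
  Matrix.PosDef.diagonal fun _ => Real.exp_pos _

theorem coneMatrix_inv (w : ℂ) : (coneMatrix β γ a ζ w)⁻¹ =
    Matrix.diagonal fun i => Real.exp (-coneExponent β γ a ζ w i) := by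
  rw [coneMatrix, inv_diagonal fun _ => (Real.exp_pos _).ne']
  simp only [Real.exp_neg]

theorem hasDerivWithinAt_coneExponent {w : ℝ → ℂ} {w' : ℂ} {S : Set ℝ} {t : ℝ}
    (h : HasDerivWithinAt w w' S t) (i : Fin n) :
    HasDerivWithinAt (fun s => coneExponent β γ a ζ (w s) i)
      (2 / (n * β) * w'.re + w'.im * (ζ i / γ)) S t :=
  (((hasDerivWithinAt_re h).const_mul _).const_add _).add ((hasDerivWithinAt_im h).mul_const _)

theorem hasEntryDeriv_coneMatrix {w : ℝ → ℂ} {w' : ℂ} {S : Set ℝ} {t : ℝ}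
    (h : HasDerivWithinAt w w' S t) :
    HasEntryDeriv (fun s => coneMatrix β γ a ζ (w s))
      (Matrix.diagonal fun i => Real.exp (coneExponent β γ a ζ (w t) i) *
        (2 / (n * β) * w'.re + w'.im * (ζ i / γ))) S t := by
  intro i j
  rcases eq_or_ne i j with rfl | hij
  · simp only [coneMatrix, Matrix.diagonal_apply_eq]
    exact (hasDerivWithinAt_coneExponent h i).exp
  · simp only [coneMatrix, Matrix.diagonal_apply_ne _ hij]
    exact hasDerivWithinAt_const _ _ _

theorem ConeData.coneMatrix_det_rpow (h : ConeData n β σ γ a b ζ) (w : ℂ) :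
    (coneMatrix β γ a ζ w).det ^ β = (∏ i, a i) ^ β * Real.exp (2 * w.re) := by
  have hn : (n : ℝ) ≠ 0 := Nat.cast_ne_zero.2 h.n_pos.ne'
  have hβ := h.β_ne
  have hs : ∑ i, coneExponent β γ a ζ w i = Real.log (∏ i, a i) + 2 / β * w.re := by
    simp only [coneExponent, Finset.sum_add_distrib, ← Finset.mul_sum, ← Finset.sum_div, h.sum_ζ,
      Real.log_prod fun i _ => (h.a_pos i).ne']
    simp
    field_simp
  rw [coneMatrix, Matrix.det_diagonal, ← Real.exp_sum, hs,
    Real.rpow_def_of_pos (Real.exp_pos _), Real.log_exp,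
    Real.rpow_def_of_pos (Finset.prod_pos fun i _ => h.a_pos i), ← Real.exp_add]
  congr 1
  field_simp

/-- The metric restricted to the cone is, up to a constant, the Euclidean metric of the developed
cone in log-polar coordinates. -/
theorem ConeData.metric_coneMatrix (h : ConeData n β σ γ a b ζ) (w w' : ℂ) :
    metric β (coneMatrix β γ a ζ w)
      (Matrix.diagonal fun i => Real.exp (coneExponent β γ a ζ w i) *
        (2 / (n * β) * w'.re + w'.im * (ζ i / γ)))
      (Matrix.diagonal fun i => Real.exp (coneExponent β γ a ζ w i) *
        (2 / (n * β) * w'.re + w'.im * (ζ i / γ))) =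
      (∏ i, a i) ^ β * (4 * (1 / n - β) / β ^ 2) * ‖Complex.exp w * w'‖ ^ 2 := by
  have hn : (n : ℝ) ≠ 0 := Nat.cast_ne_zero.2 h.n_pos.ne'
  have hβ := h.β_ne
  have hγ : γ ≠ 0 := h.γ_mem.1.ne'
  have e1 : ∀ i, Real.exp (-coneExponent β γ a ζ w i) *
      (Real.exp (coneExponent β γ a ζ w i) * (2 / (n * β) * w'.re + w'.im * (ζ i / γ))) =
      2 / (n * β) * w'.re + w'.im * (ζ i / γ) := by
    intro i
    rw [← mul_assoc, ← Real.exp_add, neg_add_cancel, Real.exp_zero, one_mul]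
  have s1 : ∑ i, (2 / (n * β) * w'.re + w'.im * (ζ i / γ)) = 2 / β * w'.re := by
    simp only [Finset.sum_add_distrib, ← Finset.mul_sum, ← Finset.sum_div, h.sum_ζ]
    simp
    field_simp
  have s2 : ∑ i, (2 / (n * β) * w'.re + w'.im * (ζ i / γ)) *
      (2 / (n * β) * w'.re + w'.im * (ζ i / γ)) =
      4 / (n * β ^ 2) * w'.re ^ 2 + w'.im ^ 2 / γ ^ 2 * ∑ i, ζ i ^ 2 := by
    have : ∀ i, (2 / (n * β) * w'.re + w'.im * (ζ i / γ)) *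
      (2 / (n * β) * w'.re + w'.im * (ζ i / γ)) = (2 / (n * β) * w'.re) ^ 2 +
      2 * (2 / (n * β) * w'.re) * (w'.im / γ) * ζ i + w'.im ^ 2 / γ ^ 2 * ζ i ^ 2 := by
      intro i
      ring
    simp only [this, Finset.sum_add_distrib, ← Finset.mul_sum, h.sum_ζ]
    simp
    field_simp
    ring
  rw [metric, mul_assoc (_ * _) (_)⁻¹, coneMatrix_inv, Matrix.diagonal_mul_diagonal,
    Matrix.diagonal_mul_diagonal, Matrix.trace_diagonal, Matrix.trace_diagonal,
    h.coneMatrix_det_rpow]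
  simp only [e1]
  rw [s1, s2, h.sum_ζ_sq, norm_mul, mul_pow, Complex.norm_exp, ← Complex.normSq_eq_norm_sq w',
    Complex.normSq_apply, two_mul, Real.exp_add]
  field_simp
  ring

/-- A curve on the cone satisfies the Euler-Lagrange equation if its log-polar coordinate `w`
satisfies `w'' = -w'²`, i.e. if `exp w` is affine. -/
theorem ConeData.eulerLagrange (h : ConeData n β σ γ a b ζ) {w w' : ℝ → ℂ}
    (hw : ∀ s ∈ Icc (0 : ℝ) 1, HasDerivWithinAt w (w' s) (Icc 0 1) s)
    (hw' : ∀ s ∈ Icc (0 : ℝ) 1, HasDerivWithinAt w' (-(w' s) ^ 2) (Icc 0 1) s)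
    (V : Matrix (Fin n) (Fin n) ℝ) {t : ℝ} (ht : t ∈ Icc (0 : ℝ) 1) :
    HasDerivWithinAt
      (fun s => metric β (coneMatrix β γ a ζ (w s))
        (velocity (fun r => coneMatrix β γ a ζ (w r)) s) V)
      (deriv (fun ε : ℝ => metric β (coneMatrix β γ a ζ (w t) + ε • V)
        (velocity (fun r => coneMatrix β γ a ζ (w r)) t)
        (velocity (fun r => coneMatrix β γ a ζ (w r)) t) / 2) 0) (Icc 0 1) t := by
  have hn : (n : ℝ) ≠ 0 := Nat.cast_ne_zero.2 h.n_pos.ne'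
  have hβ := h.β_ne
  have hγ : γ ≠ 0 := h.γ_mem.1.ne'
  set u : ℝ → Fin n → ℝ := fun s i => 2 / (n * β) * (w' s).re + (w' s).im * (ζ i / γ) with hu
  have hvel : ∀ s ∈ Icc (0 : ℝ) 1, velocity (fun r => coneMatrix β γ a ζ (w r)) s =
      Matrix.diagonal fun i => Real.exp (coneExponent β γ a ζ (w s) i) * u s i := fun s hs =>
    (hasEntryDeriv_coneMatrix (hw s hs)).velocity_eq hs
  have e1 : ∀ s i, Real.exp (-coneExponent β γ a ζ (w s) i) *
      (Real.exp (coneExponent β γ a ζ (w s) i) * u s i) = u s i := by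
    intro s i
    rw [← mul_assoc, ← Real.exp_add, neg_add_cancel, Real.exp_zero, one_mul]
  have hM : ∀ s ∈ Icc (0 : ℝ) 1, (coneMatrix β γ a ζ (w s))⁻¹ *
      velocity (fun r => coneMatrix β γ a ζ (w r)) s = Matrix.diagonal (u s) := by
    intro s hs
    rw [hvel s hs, coneMatrix_inv, Matrix.diagonal_mul_diagonal]
    simp only [e1]
  have s1 : ∀ s, ∑ i, u s i = 2 / β * (w' s).re := by
    intro s
    simp only [hu, Finset.sum_add_distrib, ← Finset.mul_sum, ← Finset.sum_div, h.sum_ζ]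
    simp
    field_simp
  -- Pairing with `V` only sees the diagonal entries of `V`.
  have hL : ∀ s ∈ Icc (0 : ℝ) 1, metric β (coneMatrix β γ a ζ (w s))
      (velocity (fun r => coneMatrix β γ a ζ (w r)) s) V =
      (∏ i, a i) ^ β * ∑ i, V i i * (Real.exp (2 * (w s).re - coneExponent β γ a ζ (w s) i) *
        ((2 / (n * β) - 2) * (w' s).re + (w' s).im * (ζ i / γ))) := by
    intro s hs
    rw [metric, hM s hs, coneMatrix_inv, h.coneMatrix_det_rpow, Matrix.diagonal_mul_diagonal,
      Matrix.trace_diagonal, s1]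
    simp only [Matrix.trace, Matrix.diag_apply, Matrix.diagonal_mul]
    rw [mul_assoc, Finset.mul_sum, ← Finset.sum_sub_distrib, Finset.mul_sum]
    congr 1
    refine Finset.sum_congr rfl fun i _ => ?_
    rw [sub_eq_add_neg (2 * (w s).re), Real.exp_add, hu]
    field_simp
    ring
  have hD : HasDerivWithinAt (fun s => (∏ i, a i) ^ β * ∑ i, V i i *
      (Real.exp (2 * (w s).re - coneExponent β γ a ζ (w s) i) *
        ((2 / (n * β) - 2) * (w' s).re + (w' s).im * (ζ i / γ))))
      ((∏ i, a i) ^ β * ∑ i, V i i *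
        (Real.exp (2 * (w t).re - coneExponent β γ a ζ (w t) i) * (2 * (w' t).re - u t i) *
          ((2 / (n * β) - 2) * (w' t).re + (w' t).im * (ζ i / γ)) +
        Real.exp (2 * (w t).re - coneExponent β γ a ζ (w t) i) *
          ((2 / (n * β) - 2) * (-(w' t) ^ 2).re + (-(w' t) ^ 2).im * (ζ i / γ))))
      (Icc 0 1) t := by
    refine (HasDerivWithinAt.fun_sum fun i _ => ?_).const_mul _
    refine HasDerivWithinAt.const_mul _ (HasDerivWithinAt.mul ?_ ?_)
    · exact (((hasDerivWithinAt_re (hw t ht)).const_mul 2).sub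
        (hasDerivWithinAt_coneExponent (hw t ht) i)).exp
    · exact ((hasDerivWithinAt_re (hw' t ht)).const_mul _).add
        ((hasDerivWithinAt_im (hw' t ht)).mul_const _)
  refine (hD.congr hL (hL t ht)).congr_deriv ?_
  have s2 : ∑ i, u t i * u t i =
      4 / (n * β ^ 2) * (w' t).re ^ 2 + (w' t).im ^ 2 / γ ^ 2 * ∑ i, ζ i ^ 2 := by
    have : ∀ i, u t i * u t i = (2 / (n * β) * (w' t).re) ^ 2 +
      2 * (2 / (n * β) * (w' t).re) * ((w' t).im / γ) * ζ i +
        (w' t).im ^ 2 / γ ^ 2 * ζ i ^ 2 := by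
      intro i
      simp only [hu]
      ring
    simp only [this, Finset.sum_add_distrib, ← Finset.mul_sum, h.sum_ζ]
    simp
    field_simp
    ring
  rw [deriv_metric_add_smul (coneMatrix_posDef _).det_pos, mul_assoc _ (_)⁻¹ (velocity _ _),
    mul_assoc _ (_)⁻¹ (velocity _ _), mul_assoc _ (_)⁻¹ (velocity _ _), hM t ht,
    mul_assoc _ (Matrix.diagonal _) (Matrix.diagonal _), Matrix.diagonal_mul_diagonal,
    Matrix.trace_diagonal, Matrix.trace_diagonal, s1, s2, h.sum_ζ_sq, coneMatrix_inv,
    h.coneMatrix_det_rpow]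
  simp only [Matrix.trace, Matrix.diag_apply, Matrix.diagonal_mul, Matrix.mul_diagonal]
  rw [mul_assoc ((∏ i, a i) ^ β)]
  congr 1
  rw [mul_assoc (β / 2), Finset.sum_mul, Finset.mul_sum, Finset.mul_sum,
    ← Finset.sum_sub_distrib, ← Finset.sum_add_distrib, Finset.mul_sum]
  refine Finset.sum_congr rfl fun i _ => ?_
  rw [sub_eq_add_neg (2 * (w t).re), Real.exp_add, hu]
  have r1 : (-(w' t) ^ 2).re = (w' t).im ^ 2 - (w' t).re ^ 2 := by
    simp [sq]
  have r2 : (-(w' t) ^ 2).im = -2 * (w' t).re * (w' t).im := by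
    simp [sq]
    ring
  rw [r1, r2]
  field_simp
  ring

end ConeMatrix

/-! ### The diagonal geodesic -/

/-- The curve on the cone whose development is the straight segment. -/
def coneGeodesic {n : ℕ} (β σ γ : ℝ) (a ζ : Fin n → ℝ) (t : ℝ) : Matrix (Fin n) (Fin n) ℝ :=
  coneMatrix β γ a ζ (Complex.log (coneSegment σ γ t))

/-- The ratio between the metric and the squared Euclidean speed in the developed cone. -/
def coneScale {n : ℕ} (β : ℝ) (a : Fin n → ℝ) : ℝ := (∏ i, a i) ^ β * (4 * (1 / n - β) / β ^ 2)

section ConeGeodesic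

variable {n : ℕ} {β σ γ : ℝ} {a b ζ : Fin n → ℝ}

theorem ConeData.coneScale_pos (h : ConeData n β σ γ a b ζ) : 0 < coneScale β a := by
  have := sub_pos.2 h.β_lt
  have := sq_pos_of_ne_zero h.β_ne
  have : 0 < (∏ i, a i) ^ β := Real.rpow_pos_of_pos (Finset.prod_pos fun i _ => h.a_pos i) β
  unfold coneScale
  positivity

theorem ConeData.coneMatrix_zero (h : ConeData n β σ γ a b ζ) :
    coneMatrix β γ a ζ 0 = Matrix.diagonal a := by
  rw [coneMatrix, Matrix.diagonal_eq_diagonal_iff]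
  intro i
  simp [coneExponent, Real.exp_log (h.a_pos i)]

theorem ConeData.log_coneSegment_one (h : ConeData n β σ γ a b ζ) :
    Complex.log (coneSegment σ γ 1) = ⟨Real.log σ, γ⟩ := by
  rw [coneSegment_one, Complex.log_ofReal_mul h.σ_pos (Complex.exp_ne_zero _), Complex.log_exp]
  · apply Complex.ext <;> simp
  · simp
    linarith [h.γ_mem.1, Real.pi_pos]
  · simpa using h.γ_mem.2.le

theorem ConeData.hasDerivWithinAt_log_coneSegment (h : ConeData n β σ γ a b ζ) {t : ℝ}
    (ht : t ∈ Icc (0 : ℝ) 1) :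
    HasDerivWithinAt (fun s => Complex.log (coneSegment σ γ s))
      ((σ * Complex.exp (γ * Complex.I) - 1) / coneSegment σ γ t) (Icc 0 1) t :=
  (hasDerivAt_coneSegment σ γ t).hasDerivWithinAt.clog_real
    (coneSegment_mem_slitPlane h.σ_pos h.γ_mem ht)

theorem ConeData.isCurveJoining_coneGeodesic (h : ConeData n β σ γ a b ζ) :
    IsCurveJoining (Matrix.diagonal a) (Matrix.diagonal b) (coneGeodesic β σ γ a ζ) where
  contDiffOn i j := by
    rcases eq_or_ne i j with rfl | hij
    · have hl : ContDiffOn ℝ 2 (fun t => Complex.log (coneSegment σ γ t)) (Icc 0 1) := by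
        intro t ht
        have h1 : ContDiffAt ℝ 2 Complex.log (coneSegment σ γ t) :=
          (Complex.contDiffAt_log (coneSegment_mem_slitPlane h.σ_pos h.γ_mem ht)).restrict_scalars ℝ
        exact (h1.comp t (contDiff_coneSegment σ γ).contDiffAt).contDiffWithinAt
      have hre := Complex.reCLM.contDiff.comp_contDiffOn hl
      have him := Complex.imCLM.contDiff.comp_contDiffOn hl
      simp only [coneGeodesic, coneMatrix, Matrix.diagonal_apply_eq, coneExponent]
      exact ((contDiffOn_const.add (contDiffOn_const.mul hre)).add
        (him.mul contDiffOn_const)).exp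
    · simp only [coneGeodesic, coneMatrix, Matrix.diagonal_apply_ne _ hij]
      exact contDiffOn_const
  posDef t _ := coneMatrix_posDef _
  source := by rw [coneGeodesic, coneSegment_zero, Complex.log_one, h.coneMatrix_zero]
  target := by
    rw [coneGeodesic, h.log_coneSegment_one, coneMatrix, Matrix.diagonal_eq_diagonal_iff]
    intro i
    have : coneExponent β γ a ζ ⟨Real.log σ, γ⟩ i = Real.log (b i) := by
      rw [coneExponent, h.log_b, mul_div_cancel₀ _ h.γ_mem.1.ne']
    rw [this, Real.exp_log (h.b_pos i)]

theorem ConeData.isGeodesic_coneGeodesic (h : ConeData n β σ γ a b ζ) :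
    IsGeodesic β (Matrix.diagonal a) (Matrix.diagonal b) (coneGeodesic β σ γ a ζ) where
  joins := h.isCurveJoining_coneGeodesic
  eulerLagrange V _ t ht := by
    refine h.eulerLagrange (fun s hs => h.hasDerivWithinAt_log_coneSegment hs) (fun s hs => ?_) V ht
    have hne := Complex.slitPlane_ne_zero (coneSegment_mem_slitPlane h.σ_pos h.γ_mem hs)
    refine ((hasDerivWithinAt_const s _ _).div
      (hasDerivAt_coneSegment σ γ s).hasDerivWithinAt hne).congr_deriv ?_
    rw [zero_mul, zero_sub, div_pow, neg_div, sq (_ - _)]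

theorem ConeData.speed_coneGeodesic (h : ConeData n β σ γ a b ζ) {t : ℝ}
    (ht : t ∈ Icc (0 : ℝ) 1) : speed β (coneGeodesic β σ γ a ζ) t =
      √(coneScale β a) * ‖(σ : ℂ) * Complex.exp (γ * Complex.I) - 1‖ := by
  have hne := Complex.slitPlane_ne_zero (coneSegment_mem_slitPlane h.σ_pos h.γ_mem ht)
  have hv := (hasEntryDeriv_coneMatrix (β := β) (γ := γ) (a := a) (ζ := ζ)
    (h.hasDerivWithinAt_log_coneSegment ht)).velocity_eq ht
  rw [speed, show coneGeodesic β σ γ a ζ =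
    fun s => coneMatrix β γ a ζ (Complex.log (coneSegment σ γ s)) from rfl, hv,
    h.metric_coneMatrix, Complex.exp_log hne, mul_div_cancel₀ _ hne, ← coneScale,
    Real.sqrt_mul h.coneScale_pos.le, Real.sqrt_sq (norm_nonneg _)]

theorem length_eq_of_speed_eq {P : ℝ → Matrix (Fin n) (Fin n) ℝ} {c : ℝ}
    (hc : ∀ t ∈ Icc (0 : ℝ) 1, speed β P t = c) : length β P = c := by
  rw [length, intervalIntegral.integral_congr (g := fun _ => c)
    (fun t ht => hc t (by rwa [uIcc_of_le zero_le_one] at ht))]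
  simp

end ConeGeodesic

/-! ### Projecting an arbitrary curve to the developed cone -/

/-- The log-polar coordinate of the projection of `X` to the cone through `diag a` in the direction
`ζ`: first `X` is replaced by the diagonal matrix of its pivots, whose logarithm is then projected
orthogonally onto the plane spanned by `(1, …, 1)` and `ζ`. -/
def coneCoord {n : ℕ} (β γ : ℝ) (a ζ : Fin n → ℝ) (X : Matrix (Fin n) (Fin n) ℝ) : ℂ :=
  ⟨β / 2 * ∑ i, (logPivot i X - Real.log (a i)),
    γ / (∑ i, ζ i ^ 2) * ∑ i, ζ i * (logPivot i X - Real.log (a i))⟩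

/-- The differential of `coneCoord` at `X`, applied to `V`. -/
def coneCoordDeriv {n : ℕ} (β γ : ℝ) (ζ : Fin n → ℝ) (X V : Matrix (Fin n) (Fin n) ℝ) : ℂ :=
  ⟨β / 2 * ∑ i, (rankOnePart i X * V).trace,
    γ / (∑ i, ζ i ^ 2) * ∑ i, ζ i * (rankOnePart i X * V).trace⟩

section ConeCoord

variable {n : ℕ} {β σ γ : ℝ} {a b ζ : Fin n → ℝ}

theorem hasDerivWithinAt_complex_mk {f g : ℝ → ℝ} {f' g' : ℝ} {S : Set ℝ} {t : ℝ}
    (hf : HasDerivWithinAt f f' S t) (hg : HasDerivWithinAt g g' S t) :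
    HasDerivWithinAt (fun s => (⟨f s, g s⟩ : ℂ)) ⟨f', g'⟩ S t := by
  have := hf.ofReal_comp.add (hg.ofReal_comp.mul_const Complex.I)
  refine (this.congr_deriv ?_).congr (fun s _ => ?_) ?_
  all_goals apply Complex.ext <;> simp

theorem HasEntryDeriv.coneCoord {X : ℝ → Matrix (Fin n) (Fin n) ℝ}
    {V : Matrix (Fin n) (Fin n) ℝ} {S : Set ℝ} {t : ℝ} (hX : HasEntryDeriv X V S t)
    (h : (X t).PosDef) :
    HasDerivWithinAt (fun s => coneCoord β γ a ζ (X s)) (coneCoordDeriv β γ ζ (X t) V) S t := by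
  exact hasDerivWithinAt_complex_mk
    ((HasDerivWithinAt.fun_sum fun i _ => (hX.logPivot h i).sub_const _).const_mul _)
    ((HasDerivWithinAt.fun_sum fun i _ =>
      ((hX.logPivot h i).sub_const _).const_mul (ζ i)).const_mul _)

theorem ConeData.sum_ζ_sq_pos (h : ConeData n β σ γ a b ζ) : 0 < ∑ i, ζ i ^ 2 := by
  have := sub_pos.2 h.β_lt
  have := sq_pos_of_ne_zero h.β_ne
  have := h.γ_mem.1
  rw [h.sum_ζ_sq]
  positivity

theorem ConeData.coneCoord_source (h : ConeData n β σ γ a b ζ) :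
    coneCoord β γ a ζ (Matrix.diagonal a) = 0 := by
  apply Complex.ext <;> simp [coneCoord, logPivot_diagonal h.a_pos]

theorem ConeData.coneCoord_target (h : ConeData n β σ γ a b ζ) :
    coneCoord β γ a ζ (Matrix.diagonal b) = ⟨Real.log σ, γ⟩ := by
  have hn : (n : ℝ) ≠ 0 := Nat.cast_ne_zero.2 h.n_pos.ne'
  have hβ := h.β_ne
  have hZ := h.sum_ζ_sq_pos.ne'
  have hd : ∀ i, logPivot i (Matrix.diagonal b) - Real.log (a i) =
      2 / (n * β) * Real.log σ + ζ i := by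
    intro i
    rw [logPivot_diagonal h.b_pos, h.log_b]
    ring
  apply Complex.ext
  · simp only [coneCoord, hd, Finset.sum_add_distrib, h.sum_ζ]
    simp
    field_simp
  · have : ∀ i, ζ i * (2 / (n * β) * Real.log σ + ζ i) =
        (2 / (n * β) * Real.log σ) * ζ i + ζ i ^ 2 := fun i => by ring
    simp only [coneCoord, hd, this, Finset.sum_add_distrib, ← Finset.mul_sum, h.sum_ζ]
    field_simp
    simp
    ring

/-- The component of `v` orthogonal to the plane spanned by `(1, …, 1)` and `ζ`. -/
theorem ConeData.sum_sq_orthogonal (h : ConeData n β σ γ a b ζ) (v : Fin n → ℝ) :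
    ∑ i, (v i - (∑ j, v j) / n - (∑ j, ζ j * v j) / (∑ j, ζ j ^ 2) * ζ i) ^ 2 =
      ∑ i, v i ^ 2 - (∑ j, v j) ^ 2 / n - (∑ j, ζ j * v j) ^ 2 / ∑ j, ζ j ^ 2 := by
  have hn : (n : ℝ) ≠ 0 := Nat.cast_ne_zero.2 h.n_pos.ne'
  have hZ := h.sum_ζ_sq_pos.ne'
  set S := ∑ j, v j with hS
  set Z := ∑ j, ζ j ^ 2 with hZd
  set m := ∑ j, ζ j * v j with hm
  have e : ∀ i, (v i - S / n - m / Z * ζ i) ^ 2 = v i ^ 2 - 2 * (S / n) * v i + (S / n) ^ 2 -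
      2 * (m / Z) * (ζ i * v i) + 2 * (S / n) * (m / Z) * ζ i + (m / Z) ^ 2 * ζ i ^ 2 := by
    intro i
    ring
  simp only [e, Finset.sum_add_distrib, Finset.sum_sub_distrib, ← Finset.mul_sum, h.sum_ζ, ← hS,
    ← hZd, ← hm]
  simp
  field_simp
  ring

/-- The metric exceeds the one of the developed cone by two nonnegative defects: the first one
is that of the projection to the pivots, the second one that of the projection of diagonal
matrices to the cone. -/
theorem ConeData.metric_eq (h : ConeData n β σ γ a b ζ) {X V : Matrix (Fin n) (Fin n) ℝ}
    (hX : X.PosDef) : metric β X V V =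
      coneScale β a * ‖Complex.exp (coneCoord β γ a ζ X) * coneCoordDeriv β γ ζ X V‖ ^ 2 +
      X.det ^ β * (((X⁻¹ * V * X⁻¹ * V).trace - ∑ i, (rankOnePart i X * V).trace ^ 2) +
        ∑ i, ((rankOnePart i X * V).trace - (∑ j, (rankOnePart j X * V).trace) / n -
          (∑ j, ζ j * (rankOnePart j X * V).trace) / (∑ j, ζ j ^ 2) * ζ i) ^ 2) := by
  have hn : (n : ℝ) ≠ 0 := Nat.cast_ne_zero.2 h.n_pos.ne'
  have hβ := h.β_ne
  have hγ := h.γ_mem.1.ne'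
  have hκ : 1 - n * β ≠ 0 := by
    have : 1 - n * β = n * (1 / n - β) := by field_simp
    rw [this]
    exact mul_ne_zero hn (sub_pos.2 h.β_lt).ne'
  have hκ' : 1 - β * n ≠ 0 := by rwa [mul_comm]
  have hdet : X.det ^ β = (∏ i, a i) ^ β * Real.exp (2 * (coneCoord β γ a ζ X).re) := by
    rw [Real.rpow_def_of_pos hX.det_pos,
      Real.rpow_def_of_pos (Finset.prod_pos fun i _ => h.a_pos i), ← Real.exp_add,
      Real.log_prod fun i _ => (h.a_pos i).ne', ← sum_logPivot]
    congr 1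
    simp only [coneCoord, Finset.sum_sub_distrib]
    ring
  have htr : (X⁻¹ * V).trace = ∑ i, (rankOnePart i X * V).trace := by
    rw [← sum_rankOnePart, Finset.sum_mul, Matrix.trace_sum]
  rw [h.sum_sq_orthogonal fun i => (rankOnePart i X * V).trace, metric, htr, norm_mul, mul_pow,
    Complex.norm_exp, ← Complex.normSq_eq_norm_sq (coneCoordDeriv β γ ζ X V), Complex.normSq_apply,
    hdet, two_mul, Real.exp_add, coneScale]
  simp only [coneCoordDeriv, h.sum_ζ_sq]
  field_simp
  ring

theorem ConeData.metric_ge (h : ConeData n β σ γ a b ζ) {X V : Matrix (Fin n) (Fin n) ℝ}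
    (hX : X.PosDef) (hV : V.IsSymm) :
    coneScale β a * ‖Complex.exp (coneCoord β γ a ζ X) * coneCoordDeriv β γ ζ X V‖ ^ 2 ≤
      metric β X V V := by
  rw [h.metric_eq hX, le_add_iff_nonneg_right]
  exact mul_nonneg (Real.rpow_nonneg hX.det_pos.le _) (add_nonneg
    (sub_nonneg.2 (sum_sq_trace_rankOnePart_le hX hV)) (Finset.sum_nonneg fun i _ => sq_nonneg _))

theorem ConeData.defects_eq_zero (h : ConeData n β σ γ a b ζ) {X V : Matrix (Fin n) (Fin n) ℝ}
    (hX : X.PosDef) (hV : V.IsSymm) (hle : metric β X V V ≤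
      coneScale β a * ‖Complex.exp (coneCoord β γ a ζ X) * coneCoordDeriv β γ ζ X V‖ ^ 2) :
    ∑ i, (rankOnePart i X * V).trace ^ 2 = (X⁻¹ * V * X⁻¹ * V).trace ∧
      ∀ i, (rankOnePart i X * V).trace = (∑ j, (rankOnePart j X * V).trace) / n +
          (∑ j, ζ j * (rankOnePart j X * V).trace) / (∑ j, ζ j ^ 2) * ζ i := by
  have h1 := sub_nonneg.2 (sum_sq_trace_rankOnePart_le hX hV)
  have h2 : 0 ≤ ∑ i, ((rankOnePart i X * V).trace - (∑ j, (rankOnePart j X * V).trace) / n -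
          (∑ j, ζ j * (rankOnePart j X * V).trace) / (∑ j, ζ j ^ 2) * ζ i) ^ 2 :=
    Finset.sum_nonneg fun i _ => sq_nonneg _
  rw [h.metric_eq hX, add_le_iff_nonpos_right] at hle
  have h3 := nonpos_of_mul_nonpos_right hle (Real.rpow_pos_of_pos hX.det_pos β)
  have h4 := le_antisymm (by linarith) h2
  refine ⟨by linarith, fun i => ?_⟩
  have := pow_eq_zero_iff two_ne_zero |>.1
    ((Finset.sum_eq_zero_iff_of_nonneg fun i _ => sq_nonneg _).1 h4 i (Finset.mem_univ i))
  linarith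

end ConeCoord

section Minimal

variable {n : ℕ} {β σ γ : ℝ} {a b ζ : Fin n → ℝ} {Q : ℝ → Matrix (Fin n) (Fin n) ℝ}

theorem hasDerivWithinAt_exp_coneCoord
    (hQ : IsCurveJoining (Matrix.diagonal a) (Matrix.diagonal b) Q) {t : ℝ}
    (ht : t ∈ Icc (0 : ℝ) 1) :
    HasDerivWithinAt (fun s => Complex.exp (coneCoord β γ a ζ (Q s)))
      (Complex.exp (coneCoord β γ a ζ (Q t)) * coneCoordDeriv β γ ζ (Q t) (velocity Q t))
      (Icc 0 1) t :=
  ((hQ.hasEntryDeriv ht).coneCoord (hQ.posDef t ht)).cexp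

theorem ConeData.exp_coneCoord_source (h : ConeData n β σ γ a b ζ)
    (hQ : IsCurveJoining (Matrix.diagonal a) (Matrix.diagonal b) Q) :
    Complex.exp (coneCoord β γ a ζ (Q 0)) = 1 := by
  rw [hQ.source, h.coneCoord_source, Complex.exp_zero]

theorem ConeData.exp_coneCoord_target (h : ConeData n β σ γ a b ζ)
    (hQ : IsCurveJoining (Matrix.diagonal a) (Matrix.diagonal b) Q) :
    Complex.exp (coneCoord β γ a ζ (Q 1)) = σ * Complex.exp (γ * Complex.I) := by
  rw [hQ.target, h.coneCoord_target, ← h.log_coneSegment_one, coneSegment_one, Complex.exp_log]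
  exact mul_ne_zero (Complex.ofReal_ne_zero.2 h.σ_pos.ne') (Complex.exp_ne_zero _)

theorem ConeData.chord_ne_zero (h : ConeData n β σ γ a b ζ) :
    (σ : ℂ) * Complex.exp (γ * Complex.I) - 1 ≠ 0 := by
  intro h0
  have := congrArg Complex.im h0
  simp [Complex.exp_ofReal_mul_I_im] at this
  rcases this with h1 | h1
  · exact h.σ_pos.ne' h1
  · exact (Real.sin_pos_of_mem_Ioo h.γ_mem).ne' h1

theorem ConeData.coneScale_mul_norm_le_speed (h : ConeData n β σ γ a b ζ)
    (hQ : IsCurveJoining (Matrix.diagonal a) (Matrix.diagonal b) Q) {t : ℝ}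
    (ht : t ∈ Icc (0 : ℝ) 1) :
    √(coneScale β a) * ‖Complex.exp (coneCoord β γ a ζ (Q t)) *
      coneCoordDeriv β γ ζ (Q t) (velocity Q t)‖ ≤ speed β Q t := by
  rw [speed, ← Real.sqrt_sq (norm_nonneg (_ * _)), ← Real.sqrt_mul h.coneScale_pos.le]
  exact Real.sqrt_le_sqrt (h.metric_ge (hQ.posDef t ht) (hQ.velocity_isSymm ht))

/-- The real part of `conj c * z`, for the chord `c`, calibrates the segment. -/
theorem hasDerivWithinAt_calibration
    (hQ : IsCurveJoining (Matrix.diagonal a) (Matrix.diagonal b) Q) (c : ℂ) {t : ℝ}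
    (ht : t ∈ Icc (0 : ℝ) 1) :
    HasDerivWithinAt (fun s => ((starRingEnd ℂ) c * Complex.exp (coneCoord β γ a ζ (Q s))).re)
      ((starRingEnd ℂ) c * (Complex.exp (coneCoord β γ a ζ (Q t)) *
        coneCoordDeriv β γ ζ (Q t) (velocity Q t))).re (Icc 0 1) t :=
  hasDerivWithinAt_re ((hasDerivWithinAt_exp_coneCoord hQ ht).const_mul _)

theorem ConeData.chord_le_length (h : ConeData n β σ γ a b ζ)
    (hQ : IsCurveJoining (Matrix.diagonal a) (Matrix.diagonal b) Q) :
    √(coneScale β a) * ‖(σ : ℂ) * Complex.exp (γ * Complex.I) - 1‖ ≤ length β Q := by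
  set c : ℂ := (σ : ℂ) * Complex.exp (γ * Complex.I) - 1 with hc
  have hc0 : 0 < ‖c‖ := norm_pos_iff.2 h.chord_ne_zero
  have hf := fun t (ht : t ∈ Icc (0 : ℝ) 1) =>
    (hasDerivWithinAt_calibration (β := β) (γ := γ) (ζ := ζ) hQ c ht).const_mul
      (√(coneScale β a) / ‖c‖)
  have key := intervalIntegral.sub_le_integral_of_hasDeriv_right_of_le zero_le_one
    (fun t ht => (hf t ht).continuousWithinAt)
    (fun t ht => ((hf t (Ioo_subset_Icc_self ht)).hasDerivAt
      (Icc_mem_nhds ht.1 ht.2)).hasDerivWithinAt)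
    ((hQ.continuousOn_speed β).integrableOn_Icc) (fun t ht => by
      refine le_trans ?_ (h.coneScale_mul_norm_le_speed hQ (Ioo_subset_Icc_self ht))
      rw [div_mul_eq_mul_div, div_le_iff₀ hc0, mul_assoc]
      refine mul_le_mul_of_nonneg_left ?_ (Real.sqrt_nonneg _)
      refine (Complex.re_le_norm _).trans ?_
      rw [norm_mul, RCLike.norm_conj, mul_comm])
  refine le_trans (le_of_eq ?_) key
  rw [h.exp_coneCoord_source hQ, h.exp_coneCoord_target hQ, ← mul_sub, ← Complex.sub_re, ← mul_sub,
    ← hc, ← Complex.normSq_eq_conj_mul_self, Complex.ofReal_re, Complex.normSq_eq_norm_sq]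
  field_simp

theorem ConeData.isMinimalGeodesic_coneGeodesic (h : ConeData n β σ γ a b ζ) :
    IsMinimalGeodesic β (Matrix.diagonal a) (Matrix.diagonal b) (coneGeodesic β σ γ a ζ) where
  joins := h.isCurveJoining_coneGeodesic
  minimal Q hQ := by
    rw [length_eq_of_speed_eq fun t ht => h.speed_coneGeodesic ht]
    exact h.chord_le_length hQ
  constantSpeed := ⟨_, fun t ht => h.speed_coneGeodesic ht⟩

/-- The development of a minimal geodesic has constant velocity. -/
theorem ConeData.deriv_exp_coneCoord_eq (h : ConeData n β σ γ a b ζ)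
    (hQ : IsCurveJoining (Matrix.diagonal a) (Matrix.diagonal b) Q)
    (hs : ∀ t ∈ Icc (0 : ℝ) 1, speed β Q t ≤
      √(coneScale β a) * ‖(σ : ℂ) * Complex.exp (γ * Complex.I) - 1‖) {t : ℝ}
    (ht : t ∈ Icc (0 : ℝ) 1) :
    Complex.exp (coneCoord β γ a ζ (Q t)) * coneCoordDeriv β γ ζ (Q t) (velocity Q t) =
      σ * Complex.exp (γ * Complex.I) - 1 := by
  set c : ℂ := (σ : ℂ) * Complex.exp (γ * Complex.I) - 1 with hc
  set z' : ℝ → ℂ := fun t =>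
    Complex.exp (coneCoord β γ a ζ (Q t)) * coneCoordDeriv β γ ζ (Q t) (velocity Q t) with hz'
  have hz'c : ∀ s ∈ Icc (0 : ℝ) 1, ‖z' s‖ ≤ ‖c‖ := fun s hs' =>
    le_of_mul_le_mul_left ((h.coneScale_mul_norm_le_speed hQ hs').trans (hs s hs'))
      (Real.sqrt_pos.2 h.coneScale_pos)
  set f : ℝ → ℝ := fun s =>
    ((starRingEnd ℂ) c * Complex.exp (coneCoord β γ a ζ (Q s))).re - ‖c‖ ^ 2 * s with hf
  have hf' : ∀ s ∈ Icc (0 : ℝ) 1,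
      HasDerivWithinAt f (((starRingEnd ℂ) c * z' s).re - ‖c‖ ^ 2) (Icc 0 1) s := by
    intro s hs'
    have := (hasDerivWithinAt_calibration (β := β) (γ := γ) (ζ := ζ) hQ c hs').fun_sub
      ((hasDerivWithinAt_id s (Icc 0 1)).const_mul (‖c‖ ^ 2))
    exact this.congr_deriv (by rw [mul_one])
  have hneg : ∀ s ∈ Icc (0 : ℝ) 1, ((starRingEnd ℂ) c * z' s).re - ‖c‖ ^ 2 ≤ 0 := by
    intro s hs'
    have h1 := Complex.re_le_norm ((starRingEnd ℂ) c * z' s)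
    rw [norm_mul, RCLike.norm_conj] at h1
    nlinarith [hz'c s hs', norm_nonneg c]
  have hanti : AntitoneOn f (Icc 0 1) := by
    refine antitoneOn_of_deriv_nonpos (convex_Icc 0 1) (fun s hs' => (hf' s hs').continuousWithinAt)
      ?_ ?_
    · intro s hs'
      rw [interior_Icc] at hs' ⊢
      exact ((hf' s (Ioo_subset_Icc_self hs')).mono Ioo_subset_Icc_self).differentiableWithinAt
    · intro s hs'
      rw [interior_Icc] at hs'
      rw [((hf' s (Ioo_subset_Icc_self hs')).hasDerivAt (Icc_mem_nhds hs'.1 hs'.2)).deriv]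
      exact hneg s (Ioo_subset_Icc_self hs')
  have hends : f 1 = f 0 := by
    have e : ((starRingEnd ℂ) c * (σ * Complex.exp (γ * Complex.I)) -
        (starRingEnd ℂ) c * 1).re = ‖c‖ ^ 2 := by
      rw [← mul_sub, ← hc, ← Complex.normSq_eq_conj_mul_self, Complex.ofReal_re,
        Complex.normSq_eq_norm_sq]
    rw [Complex.sub_re] at e
    simp only [hf, h.exp_coneCoord_source hQ, h.exp_coneCoord_target hQ]
    linarith
  have hconst : ∀ s ∈ Icc (0 : ℝ) 1, f s = f 0 := fun s hs' =>
    le_antisymm (hanti (left_mem_Icc.2 zero_le_one) hs' hs'.1)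
      (hends ▸ hanti hs' (right_mem_Icc.2 zero_le_one) hs'.2)
  have hre : ((starRingEnd ℂ) c * z' t).re - ‖c‖ ^ 2 = 0 :=
    (uniqueDiffOn_Icc one_pos t ht).eq_deriv _ (hf' t ht)
      ((hasDerivWithinAt_const t _ (f 0)).congr hconst (hconst t ht))
  have hnorm : ‖z' t - c‖ ^ 2 = ‖z' t‖ ^ 2 + ‖c‖ ^ 2 - 2 * ((starRingEnd ℂ) c * z' t).re := by
    simp only [← Complex.normSq_eq_norm_sq, Complex.normSq_sub]
    rw [mul_comm (z' t)]
  have hle : ‖z' t - c‖ ^ 2 ≤ 0 := by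
    nlinarith [hz'c t ht, norm_nonneg (z' t)]
  exact sub_eq_zero.1 (norm_eq_zero.1 (pow_eq_zero_iff two_ne_zero |>.1
    (le_antisymm hle (sq_nonneg _))))

theorem ConeData.eqOn_of_isMinimalGeodesic (h : ConeData n β σ γ a b ζ)
    (hQ : IsMinimalGeodesic β (Matrix.diagonal a) (Matrix.diagonal b) Q) :
    EqOn Q (coneGeodesic β σ γ a ζ) (Icc 0 1) := by
  obtain ⟨hJ, hmin, c₀, hc₀⟩ := hQ
  have hs : ∀ t ∈ Icc (0 : ℝ) 1, speed β Q t ≤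
      √(coneScale β a) * ‖(σ : ℂ) * Complex.exp (γ * Complex.I) - 1‖ := by
    intro t ht
    have := hmin _ h.isCurveJoining_coneGeodesic
    rwa [length_eq_of_speed_eq hc₀, length_eq_of_speed_eq fun t ht => h.speed_coneGeodesic ht,
      ← hc₀ t ht] at this
  have hz' := fun t ht => h.deriv_exp_coneCoord_eq hJ hs (t := t) ht
  have hdef := fun t (ht : t ∈ Icc (0 : ℝ) 1) =>
    h.defects_eq_zero (hJ.posDef t ht) (hJ.velocity_isSymm ht) (by
      have h1 := hs t ht
      rw [speed, ← Real.sqrt_sq (norm_nonneg _), ← Real.sqrt_mul h.coneScale_pos.le] at h1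
      rw [hz' t ht]
      exact (Real.sqrt_le_sqrt_iff (mul_nonneg h.coneScale_pos.le (sq_nonneg _))).1 h1)
  have hw := fun t (ht : t ∈ Icc (0 : ℝ) 1) =>
    (hJ.hasEntryDeriv ht).coneCoord (β := β) (γ := γ) (a := a) (ζ := ζ) (hJ.posDef t ht)
  have hlp := fun t (ht : t ∈ Icc (0 : ℝ) 1) k => (hJ.hasEntryDeriv ht).logPivot (hJ.posDef t ht) k
  have hw0 : coneCoord β γ a ζ (Q 0) = 0 := by rw [hJ.source, h.coneCoord_source]
  have hlp0 : ∀ k, logPivot k (Q 0) = Real.log (a k) := fun k => by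
    rw [hJ.source, logPivot_diagonal h.a_pos]
  intro t ht
  -- The pivots are those of the point of the cone with the same coordinate.
  have hpiv : ∀ k, logPivot k (Q t) = coneExponent β γ a ζ (coneCoord β γ a ζ (Q t)) k := by
    intro k
    have := sub_eq_of_hasDerivWithinAt_eq (f := fun s => logPivot k (Q s))
      (g := fun s => coneExponent β γ a ζ (coneCoord β γ a ζ (Q s)) k) (fun s hs => hlp s hs k)
      (fun s hs => (hasDerivWithinAt_coneExponent (hw s hs) k).congr_deriv (by
        have hn : (n : ℝ) ≠ 0 := Nat.cast_ne_zero.2 h.n_pos.ne'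
        have hβ := h.β_ne
        have hγ := h.γ_mem.1.ne'
        have hZ := h.sum_ζ_sq_pos.ne'
        rw [(hdef s hs).2 k]
        simp only [coneCoordDeriv]
        field_simp)) ht
    rw [hlp0, hw0] at this
    have e0 : coneExponent β γ a ζ 0 k = Real.log (a k) := by simp [coneExponent]
    rw [e0] at this
    linarith
  -- The rank-one parts keep their directions, which are those of the standard basis.
  have hrank : ∀ k, rankOnePart k (Q t) =
      Matrix.diagonal (Pi.single k (Real.exp (-logPivot k (Q t)))) := by
    intro k
    ext i j
    have := eq_mul_exp_of_hasDerivWithinAt (f := fun s => rankOnePart k (Q s) i j)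
      (g := fun s => -logPivot k (Q s)) (fun s hs =>
        ((hJ.hasEntryDeriv hs).rankOnePart (hJ.posDef s hs) k i j).congr_deriv (by
          rw [rankOnePart_variation (hJ.posDef s hs) (hJ.velocity_isSymm hs) (hdef s hs).1 k,
            Matrix.neg_apply, Matrix.smul_apply, smul_eq_mul, neg_mul_eq_neg_mul]))
      (fun s hs => (hlp s hs k).fun_neg) ht
    rw [this, hlp0, hJ.source, rankOnePart_diagonal h.a_pos]
    rcases eq_or_ne i j with rfl | hij
    · rcases eq_or_ne i k with rfl | hik
      · simp only [Matrix.diagonal_apply_eq, Pi.single_eq_same, sub_neg_eq_add]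
        rw [Real.exp_add, Real.exp_log (h.a_pos i), mul_comm (Real.exp _), ← mul_assoc,
          inv_mul_cancel₀ (h.a_pos i).ne', one_mul]
      · simp [Pi.single_eq_of_ne hik]
    · simp [Matrix.diagonal_apply_ne _ hij]
  have hinv : (Q t)⁻¹ = (coneMatrix β γ a ζ (coneCoord β γ a ζ (Q t)))⁻¹ := by
    rw [← sum_rankOnePart, coneMatrix_inv]
    simp only [hrank, ← hpiv]
    ext i j
    rw [Matrix.sum_apply]
    rcases eq_or_ne i j with rfl | hij
    · simp [Pi.single_apply]
    · simp [Matrix.diagonal_apply_ne _ hij]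
  have hQt : Q t = coneMatrix β γ a ζ (coneCoord β γ a ζ (Q t)) := by
    have h1 := Matrix.nonsing_inv_nonsing_inv (Q t)
      (isUnit_iff_ne_zero.2 (hJ.det_pos ht).ne')
    rw [hinv, Matrix.nonsing_inv_nonsing_inv _
      (isUnit_iff_ne_zero.2 (coneMatrix_posDef _).det_pos.ne')] at h1
    exact h1.symm
  rw [hQt, coneGeodesic]
  congr 1
  refine eq_log_coneSegment h.σ_pos h.γ_mem (w := fun s => coneCoord β γ a ζ (Q s)) hw hw0
    (fun s hs => ?_) ht
  have := sub_eq_of_hasDerivWithinAt_eq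
    (f := fun s => Complex.exp (coneCoord β γ a ζ (Q s))) (g := coneSegment σ γ)
    (fun r hr => (hasDerivWithinAt_exp_coneCoord hJ hr).congr_deriv (hz' r hr))
    (fun r _ => (hasDerivAt_coneSegment σ γ r).hasDerivWithinAt) hs
  rw [h.exp_coneCoord_source hJ, coneSegment_zero] at this
  exact sub_left_injective this

end Minimal

/-! ### First integrals of the geodesic equation -/

theorem exists_primitive {f : ℝ → ℝ} (hf : ContinuousOn f (Icc 0 1)) :
    ∃ F : ℝ → ℝ, F 0 = 0 ∧ ∀ t ∈ Icc (0 : ℝ) 1, HasDerivWithinAt F (f t) (Icc 0 1) t := by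
  have hg : Continuous (IccExtend (zero_le_one' ℝ) ((Icc 0 1).domRestrict f)) :=
    (continuousOn_iff_continuous_domRestrict.1 hf).Icc_extend'
  refine ⟨fun t => ∫ x in (0 : ℝ)..t, IccExtend (zero_le_one' ℝ) ((Icc 0 1).domRestrict f) x,
    intervalIntegral.integral_same, fun t ht => ?_⟩
  refine ((hg.integral_hasStrictDerivAt 0 t).hasDerivAt.hasDerivWithinAt).congr_deriv ?_
  rw [IccExtend_of_mem _ _ ht]
  rfl

/-- The symmetric matrix that represents the covector `V ↦ g_X (U, V)` in the trace form. -/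
def momentum {n : ℕ} (β : ℝ) (X U : Matrix (Fin n) (Fin n) ℝ) : Matrix (Fin n) (Fin n) ℝ :=
  X.det ^ β • (X⁻¹ * U * X⁻¹ - (β * (X⁻¹ * U).trace) • X⁻¹)

/-- The symmetric matrix that represents the differential of `X ↦ g_X (U, U) / 2` in the trace
form. -/
def force {n : ℕ} (β : ℝ) (X U : Matrix (Fin n) (Fin n) ℝ) : Matrix (Fin n) (Fin n) ℝ :=
  X.det ^ β • ((β / 2 * ((X⁻¹ * U * X⁻¹ * U).trace - β * (X⁻¹ * U).trace * (X⁻¹ * U).trace)) • X⁻¹ -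
    X⁻¹ * U * X⁻¹ * U * X⁻¹ + (β * (X⁻¹ * U).trace) • (X⁻¹ * U * X⁻¹))

section FirstIntegral

variable {n : ℕ} {β : ℝ} {A B X U : Matrix (Fin n) (Fin n) ℝ} {Q : ℝ → Matrix (Fin n) (Fin n) ℝ}

theorem momentum_isSymm (hX : X.IsSymm) (hU : U.IsSymm) : (momentum β X U).IsSymm := by
  simp only [Matrix.IsSymm, momentum, Matrix.transpose_smul, Matrix.transpose_sub,
    Matrix.transpose_mul, Matrix.transpose_nonsing_inv, hX.eq, hU.eq, mul_assoc]

theorem force_isSymm (hX : X.IsSymm) (hU : U.IsSymm) : (force β X U).IsSymm := by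
  simp only [Matrix.IsSymm, force, Matrix.transpose_smul, Matrix.transpose_sub,
    Matrix.transpose_add, Matrix.transpose_mul, Matrix.transpose_nonsing_inv, hX.eq, hU.eq,
    mul_assoc]

theorem trace_momentum_mul (V : Matrix (Fin n) (Fin n) ℝ) :
    (momentum β X U * V).trace = metric β X U V := by
  simp only [momentum, metric, Matrix.smul_mul, Matrix.trace_smul, sub_mul, Matrix.trace_sub,
    smul_eq_mul]

theorem trace_force_mul (hX : 0 < X.det) (V : Matrix (Fin n) (Fin n) ℝ) :
    (force β X U * V).trace = deriv (fun ε : ℝ => metric β (X + ε • V) U U / 2) 0 := by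
  have h1 : (X⁻¹ * V * X⁻¹ * U * X⁻¹ * U).trace = (X⁻¹ * U * X⁻¹ * U * X⁻¹ * V).trace := by
    rw [mul_assoc (X⁻¹ * V * X⁻¹ * U), mul_assoc (X⁻¹ * V), mul_assoc (X⁻¹ * V),
      Matrix.trace_mul_comm]
    simp only [mul_assoc]
  have h2 : (X⁻¹ * V * X⁻¹ * U).trace = (X⁻¹ * U * X⁻¹ * V).trace := by
    rw [mul_assoc (X⁻¹ * V), Matrix.trace_mul_comm, mul_assoc (X⁻¹ * U)]
  rw [deriv_metric_add_smul hX, h1, h2]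
  simp only [force, Matrix.smul_mul, Matrix.trace_smul, sub_mul, add_mul, Matrix.trace_sub,
    Matrix.trace_add, smul_eq_mul]
  ring

theorem trace_mul_single_add_single {M : Matrix (Fin n) (Fin n) ℝ} (hM : M.IsSymm) (i j : Fin n) :
    (M * (Matrix.single i j 1 + Matrix.single j i 1)).trace = 2 * M i j := by
  rw [mul_add, Matrix.trace_add, Matrix.trace_mul_single, Matrix.trace_mul_single, hM.apply]
  simp
  ring

theorem IsGeodesic.hasEntryDeriv_momentum (hQ : IsGeodesic β A B Q) {t : ℝ}
    (ht : t ∈ Icc (0 : ℝ) 1) :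
    HasEntryDeriv (fun s => momentum β (Q s) (velocity Q s)) (force β (Q t) (velocity Q t))
      (Icc 0 1) t := by
  intro i j
  have hV : (Matrix.single i j (1 : ℝ) + Matrix.single j i 1).IsSymm := by
    simp [Matrix.IsSymm, add_comm]
  have h := (hQ.eulerLagrange _ hV t ht).div_const 2
  rw [← trace_force_mul (hQ.joins.det_pos ht),
    trace_mul_single_add_single (force_isSymm (hQ.joins.isSymm ht) (hQ.joins.velocity_isSymm ht)),
    mul_div_cancel_left₀ _ two_ne_zero] at h
  have e : ∀ s ∈ Icc (0 : ℝ) 1, momentum β (Q s) (velocity Q s) i j =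
      metric β (Q s) (velocity Q s) (Matrix.single i j (1 : ℝ) + Matrix.single j i 1) / 2 := by
    intro s hs
    rw [← trace_momentum_mul, trace_mul_single_add_single (momentum_isSymm (hQ.joins.isSymm hs)
      (hQ.joins.velocity_isSymm hs)), mul_div_cancel_left₀ _ two_ne_zero]
  exact h.congr e (e t ht)

theorem mul_momentum (hX : IsUnit X.det) :
    X * momentum β X U = X.det ^ β • (U * X⁻¹ - (β * (X⁻¹ * U).trace) • 1) := by
  rw [momentum, Matrix.mul_smul, mul_sub, Matrix.mul_smul, Matrix.mul_nonsing_inv _ hX,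
    ← mul_assoc, Matrix.mul_nonsing_inv_cancel_left _ _ hX]

theorem mul_momentum_add_mul_force (hX : IsUnit X.det) :
    U * momentum β X U + X * force β X U =
      (β / 2 * metric β X U U) • (1 : Matrix (Fin n) (Fin n) ℝ) := by
  have h1 : X * (X⁻¹ * U * X⁻¹ * U * X⁻¹) = U * X⁻¹ * U * X⁻¹ := by
    simp only [mul_assoc, Matrix.mul_nonsing_inv_cancel_left _ _ hX]
  have h2 : X * (X⁻¹ * U * X⁻¹) = U * X⁻¹ := by
    simp only [mul_assoc, Matrix.mul_nonsing_inv_cancel_left _ _ hX]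
  have h3 : U * (X⁻¹ * U * X⁻¹) = U * X⁻¹ * U * X⁻¹ := by simp only [mul_assoc]
  rw [momentum, force, metric, Matrix.mul_smul, Matrix.mul_smul, mul_sub, mul_add, mul_sub,
    Matrix.mul_smul, Matrix.mul_smul, Matrix.mul_smul, h1, h2, h3, Matrix.mul_nonsing_inv _ hX]
  module

/-- The conserved matrix of a geodesic, i.e. the traceless part of `X Π` for the momentum `Π`. It is
the Noether charge of the isometries `X ↦ g X gᵀ`, `det g = ±1`. -/
def charge {n : ℕ} (β : ℝ) (Q : ℝ → Matrix (Fin n) (Fin n) ℝ) (t : ℝ) :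
    Matrix (Fin n) (Fin n) ℝ :=
  (Q t).det ^ β •
    (velocity Q t * (Q t)⁻¹ - (((Q t)⁻¹ * velocity Q t).trace / n) • (1 : Matrix (Fin n) (Fin n) ℝ))

theorem IsGeodesic.hasEntryDeriv_mul_momentum (hQ : IsGeodesic β A B Q) {t : ℝ}
    (ht : t ∈ Icc (0 : ℝ) 1) :
    HasEntryDeriv (fun s => Q s * momentum β (Q s) (velocity Q s))
      ((β / 2 * metric β (Q t) (velocity Q t) (velocity Q t)) • (1 : Matrix (Fin n) (Fin n) ℝ))
      (Icc 0 1) t := by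
  rw [← mul_momentum_add_mul_force (isUnit_iff_ne_zero.2 (hQ.joins.det_pos ht).ne')]
  exact (hQ.joins.hasEntryDeriv ht).mul (hQ.hasEntryDeriv_momentum ht)

theorem IsCurveJoining.trace_mul_momentum (hQ : IsCurveJoining A B Q) {t : ℝ}
    (ht : t ∈ Icc (0 : ℝ) 1) : (Q t * momentum β (Q t) (velocity Q t)).trace =
      (1 - n * β) * ((Q t).det ^ β * ((Q t)⁻¹ * velocity Q t).trace) := by
  rw [mul_momentum (isUnit_iff_ne_zero.2 (hQ.det_pos ht).ne'), Matrix.trace_smul,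
    Matrix.trace_sub, Matrix.trace_smul, Matrix.trace_one, Matrix.trace_mul_comm,
    Fintype.card_fin, smul_eq_mul, smul_eq_mul]
  ring

theorem IsGeodesic.charge_eq (hQ : IsGeodesic β A B Q) (hn : 0 < n) {t : ℝ}
    (ht : t ∈ Icc (0 : ℝ) 1) : charge β Q t = charge β Q 0 := by
  have hn' : (n : ℝ) ≠ 0 := Nat.cast_ne_zero.2 hn.ne'
  have e : ∀ s ∈ Icc (0 : ℝ) 1, charge β Q s = Q s * momentum β (Q s) (velocity Q s) -
      ((Q s * momentum β (Q s) (velocity Q s)).trace / n) • (1 : Matrix (Fin n) (Fin n) ℝ) := by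
    intro s hs
    rw [hQ.joins.trace_mul_momentum hs, mul_momentum (isUnit_iff_ne_zero.2
      (hQ.joins.det_pos hs).ne'), charge, smul_sub, smul_sub, smul_smul, smul_smul, sub_sub,
      ← add_smul]
    congr 2
    field_simp
    ring
  ext i j
  refine eq_of_hasDerivWithinAt_zero (f := fun s => charge β Q s i j) (fun s hs => ?_) ht
  have h1 := hQ.hasEntryDeriv_mul_momentum hs
  have h2 := h1.sub (HasEntryDeriv.smul (h1.trace.div_const n) (HasEntryDeriv.const 1))
  refine ((h2 i j).congr (fun r hr => by rw [e r hr]) (by rw [e s hs])).congr_deriv ?_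
  rw [smul_zero, add_zero, Matrix.trace_smul, Matrix.trace_one, Fintype.card_fin, smul_eq_mul,
    mul_div_cancel_right₀ _ hn', sub_self, Matrix.zero_apply]

theorem IsCurveJoining.hasDerivWithinAt_det_rpow (hQ : IsCurveJoining A B Q) {t : ℝ}
    (ht : t ∈ Icc (0 : ℝ) 1) : HasDerivWithinAt (fun s => (Q s).det ^ β)
      (β * ((Q t).det ^ β * ((Q t)⁻¹ * velocity Q t).trace)) (Icc 0 1) t := by
  rw [← mul_assoc]
  exact (hQ.hasEntryDeriv ht).det_rpow (hQ.det_pos ht) β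

theorem IsCurveJoining.velocity_eq_mul (hQ : IsCurveJoining A B Q) {t : ℝ}
    (ht : t ∈ Icc (0 : ℝ) 1) : velocity Q t =
      (((Q t).det ^ β)⁻¹ • charge β Q t + (((Q t)⁻¹ * velocity Q t).trace / n) • 1) * Q t := by
  have hs := (Real.rpow_pos_of_pos (hQ.det_pos ht) β).ne'
  rw [charge, smul_smul, inv_mul_cancel₀ hs, one_smul, sub_add_cancel,
    Matrix.nonsing_inv_mul_cancel_right _ _ (isUnit_iff_ne_zero.2 (hQ.det_pos ht).ne')]

theorem IsCurveJoining.charge_mul_isSymm (hQ : IsCurveJoining A B Q) {t : ℝ}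
    (ht : t ∈ Icc (0 : ℝ) 1) : (charge β Q t * Q t).IsSymm := by
  have : charge β Q t * Q t = (Q t).det ^ β •
      (velocity Q t - (((Q t)⁻¹ * velocity Q t).trace / n) • Q t) := by
    rw [charge, Matrix.smul_mul, sub_mul, Matrix.smul_mul, one_mul,
      Matrix.nonsing_inv_mul_cancel_right _ _ (isUnit_iff_ne_zero.2 (hQ.det_pos ht).ne')]
  rw [this, Matrix.IsSymm, Matrix.transpose_smul, Matrix.transpose_sub, Matrix.transpose_smul,
    (hQ.velocity_isSymm ht).eq, (hQ.isSymm ht).eq]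

/-- The second derivative of `(det X) ^ β` along a geodesic. It turns out to be constant, i.e.
`(det X) ^ β` is the squared distance of a point on a line from the origin. -/
theorem IsGeodesic.hasDerivWithinAt_deriv_det_rpow (hQ : IsGeodesic β A B Q) (hn : 0 < n)
    (hβ : β ≠ 0) (hβn : β < 1 / n) {t : ℝ} (ht : t ∈ Icc (0 : ℝ) 1) :
    HasDerivWithinAt (fun s => β * ((Q s).det ^ β * ((Q s)⁻¹ * velocity Q s).trace))
      ((β ^ 2 / (1 / n - β) * (charge β Q t * charge β Q t).trace +
        (β * ((Q t).det ^ β * ((Q t)⁻¹ * velocity Q t).trace)) ^ 2) / (2 * (Q t).det ^ β))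
      (Icc 0 1) t := by
  have hn' : (n : ℝ) ≠ 0 := Nat.cast_ne_zero.2 hn.ne'
  have hκ : 1 - n * β ≠ 0 := by
    have : 1 - n * β = n * (1 / n - β) := by field_simp
    rw [this]
    exact mul_ne_zero hn' (sub_pos.2 hβn).ne'
  have hκ' : 1 - β * n ≠ 0 := by rwa [mul_comm]
  have hs := (Real.rpow_pos_of_pos (hQ.joins.det_pos ht) β).ne'
  have h := ((hQ.hasEntryDeriv_mul_momentum ht).trace.const_mul (β / (1 - n * β)))
  have e : ∀ s ∈ Icc (0 : ℝ) 1, β * ((Q s).det ^ β * ((Q s)⁻¹ * velocity Q s).trace) =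
      β / (1 - n * β) * (Q s * momentum β (Q s) (velocity Q s)).trace := by
    intro s hs
    rw [hQ.joins.trace_mul_momentum hs]
    field_simp
  refine (h.congr e (e t ht)).congr_deriv ?_
  have hc : (charge β Q t * charge β Q t).trace = ((Q t).det ^ β) ^ 2 *
      (((Q t)⁻¹ * velocity Q t * (Q t)⁻¹ * velocity Q t).trace -
        ((Q t)⁻¹ * velocity Q t).trace ^ 2 / n) := by
    have e1 : (velocity Q t * (Q t)⁻¹ * (velocity Q t * (Q t)⁻¹)).trace =
        ((Q t)⁻¹ * velocity Q t * (Q t)⁻¹ * velocity Q t).trace := by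
      rw [← mul_assoc, Matrix.trace_mul_comm]
      simp only [mul_assoc]
    have e2 : (velocity Q t * (Q t)⁻¹).trace = ((Q t)⁻¹ * velocity Q t).trace :=
      Matrix.trace_mul_comm _ _
    simp only [charge, Matrix.smul_mul, Matrix.mul_smul, Matrix.trace_smul, mul_sub, sub_mul,
      Matrix.trace_sub, e1, e2, mul_one, one_mul, Matrix.trace_one, Fintype.card_fin, smul_eq_mul]
    field_simp
    ring
  rw [hc, Matrix.trace_smul, Matrix.trace_one, Fintype.card_fin, smul_eq_mul, metric]
  generalize ((Q t)⁻¹ * velocity Q t).trace = τ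
  generalize ((Q t)⁻¹ * velocity Q t * (Q t)⁻¹ * velocity Q t).trace = q
  generalize (Q t).det ^ β = s at hs
  field_simp
  ring

end FirstIntegral

/-! ### Uniqueness of geodesics between diagonal matrices -/

section Unique

variable {n : ℕ} {β σ γ : ℝ} {a b ζ : Fin n → ℝ} {Q : ℝ → Matrix (Fin n) (Fin n) ℝ}

theorem eq_zero_of_mulVec_eigenvectorBasis {S M : Matrix (Fin n) (Fin n) ℝ} (hS : S.IsHermitian)
    (h : ∀ j, M *ᵥ ⇑(hS.eigenvectorBasis j) = 0) : M = 0 := by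
  have : Matrix.toEuclideanLin M = 0 := by
    refine hS.eigenvectorBasis.toBasis.ext fun j => ?_
    simp [Matrix.toLpLin_apply, h j]
  simpa using this

theorem ConeData.log_det_rpow_sub (h : ConeData n β σ γ a b ζ) :
    Real.log ((Matrix.diagonal b).det ^ β) - Real.log ((Matrix.diagonal a).det ^ β) =
      2 * Real.log σ := by
  have hn : (n : ℝ) ≠ 0 := Nat.cast_ne_zero.2 h.n_pos.ne'
  have hβ := h.β_ne
  rw [Matrix.det_diagonal, Matrix.det_diagonal,
    Real.log_rpow (Finset.prod_pos fun i _ => h.a_pos i),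
    Real.log_rpow (Finset.prod_pos fun i _ => h.b_pos i),
    Real.log_prod fun i _ => (h.a_pos i).ne', Real.log_prod fun i _ => (h.b_pos i).ne']
  simp only [h.log_b, Finset.sum_add_distrib, h.sum_ζ]
  simp
  field_simp
  ring

/-- The charge of a geodesic between diagonal matrices is diagonal. Since `X` evolves by the
exponential of `τ C`, where `τ` is a primitive of `(det X) ^ (-β)`, the end points determine `τ C`
through the uniqueness of the symmetric logarithm. -/
theorem ConeData.charge_eq_diagonal (h : ConeData n β σ γ a b ζ)
    (hQ : IsGeodesic β (Matrix.diagonal a) (Matrix.diagonal b) Q) {τ : ℝ → ℝ} (hτ0 : τ 0 = 0)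
    (hτ : ∀ t ∈ Icc (0 : ℝ) 1, HasDerivWithinAt τ ((Q t).det ^ β)⁻¹ (Icc 0 1) t) :
    τ 1 ≠ 0 ∧ charge β Q 0 = Matrix.diagonal fun i => ζ i / τ 1 := by
  have hJ := hQ.joins
  have hn : (n : ℝ) ≠ 0 := Nat.cast_ne_zero.2 h.n_pos.ne'
  have hβ := h.β_ne
  set C := charge β Q 0 with hC
  have hsq : ∀ i, √(a i) ≠ 0 := fun i => (Real.sqrt_pos.2 (h.a_pos i)).ne'
  have hsq2 : ∀ i, √(a i) * √(a i) = a i := fun i => Real.mul_self_sqrt (h.a_pos i).le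
  have hCa : ∀ i j, C i j * a j = C j i * a i := by
    intro i j
    have := hJ.charge_mul_isSymm (β := β) (left_mem_Icc.2 zero_le_one)
    rw [← hC, hJ.source] at this
    simpa [Matrix.mul_diagonal] using this.apply j i
  -- `C` is conjugate to a symmetric matrix.
  set S : Matrix (Fin n) (Fin n) ℝ := Matrix.of fun i j => C i j * √(a j) / √(a i) with hSdef
  have hS : S.IsHermitian := by
    ext i j
    simp only [Matrix.conjTranspose_apply, hSdef, Matrix.of_apply, star_trivial]
    rw [div_eq_div_iff (hsq j) (hsq i), mul_assoc, mul_assoc, hsq2, hsq2, hCa]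
  have key : ∀ k, (τ 1 • S - Matrix.diagonal ζ) *ᵥ ⇑(hS.eigenvectorBasis k) = 0 := by
    intro k
    set μ := hS.eigenvalues k
    set u : Fin n → ℝ := ⇑(hS.eigenvectorBasis k) with hu
    have hSu : S *ᵥ u = μ • u := hS.mulVec_eigenvectorBasis k
    -- An eigenvector of `Cᵀ`.
    set v : Fin n → ℝ := fun j => u j / √(a j) with hv
    have hCv : C.transpose *ᵥ v = μ • v := by
      ext i
      have h1 := congrFun hSu i
      rw [Pi.smul_apply, smul_eq_mul] at h1 ⊢
      rw [hv, mul_div_assoc', ← h1, eq_div_iff (hsq i)]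
      simp only [Matrix.mulVec, dotProduct, Matrix.transpose_apply, Finset.sum_mul]
      refine Finset.sum_congr rfl fun j _ => ?_
      have h2 := hS.apply i j
      simp only [star_trivial, hSdef, Matrix.of_apply] at h2
      rw [hSdef, Matrix.of_apply, ← h2]
      ring
    have hvel : ∀ t ∈ Icc (0 : ℝ) 1, velocity Q t *ᵥ v =
        (μ * ((Q t).det ^ β)⁻¹ + ((Q t)⁻¹ * velocity Q t).trace / n) • (Q t *ᵥ v) := by
      intro t ht
      have h1 := congrArg Matrix.transpose (hJ.velocity_eq_mul (β := β) ht)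
      rw [hQ.charge_eq h.n_pos ht, ← hC, (hJ.velocity_isSymm ht).eq, Matrix.transpose_mul,
        (hJ.isSymm ht).eq, Matrix.transpose_add, Matrix.transpose_smul, Matrix.transpose_smul,
        Matrix.transpose_one] at h1
      rw [h1, ← Matrix.mulVec_mulVec, Matrix.add_mulVec, Matrix.smul_mulVec, Matrix.smul_mulVec,
        hCv, Matrix.one_mulVec, smul_smul, ← add_smul, Matrix.mulVec_smul, mul_comm μ, ← h1]
    have hend : ∀ i, b i * v i = a i * v i * Real.exp (μ * τ 1 + 1 / (n * β) * (2 * Real.log σ)) := by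
      intro i
      have := eq_mul_exp_of_hasDerivWithinAt (f := fun s => (Q s *ᵥ v) i)
        (g := fun s => μ * τ s + 1 / (n * β) * Real.log ((Q s).det ^ β))
        (g' := fun s => μ * ((Q s).det ^ β)⁻¹ + ((Q s)⁻¹ * velocity Q s).trace / n)
        (fun s hs => by
          have h1 : HasDerivWithinAt (fun r => (Q r *ᵥ v) i) ((velocity Q s *ᵥ v) i)
              (Icc 0 1) s := by
            simp only [Matrix.mulVec, dotProduct]
            exact HasDerivWithinAt.fun_sum fun j _ => (hJ.hasEntryDeriv hs i j).mul_const (v j)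
          rw [hvel s hs] at h1
          exact h1)
        (fun s hs => by
          have hs0 := (Real.rpow_pos_of_pos (hJ.det_pos hs) β).ne'
          refine (((hτ s hs).const_mul μ).add
            (((hJ.hasDerivWithinAt_det_rpow hs).log hs0).const_mul _)).congr_deriv ?_
          field_simp) (right_mem_Icc.2 zero_le_one)
      simp only [hJ.source, hJ.target, Matrix.mulVec_diagonal, hτ0] at this
      rw [this, ← h.log_det_rpow_sub]
      congr 2
      ring
    have hμ : ∀ i, τ 1 * (μ * u i) = ζ i * u i := by
      intro i
      rcases eq_or_ne (u i) 0 with h0 | h0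
      · rw [h0, mul_zero, mul_zero, mul_zero]
      · have hv0 : v i ≠ 0 := div_ne_zero h0 (hsq i)
        have h1 := hend i
        rw [mul_right_comm] at h1
        have h2 := congrArg Real.log (mul_right_cancel₀ hv0 h1)
        rw [Real.log_mul (h.a_pos i).ne' (Real.exp_ne_zero _), Real.log_exp, h.log_b] at h2
        have h3 : ζ i = μ * τ 1 := by
          have : 2 / (n * β) * Real.log σ = 1 / (n * β) * (2 * Real.log σ) := by ring
          linarith
        rw [h3]
        ring
    ext i
    rw [Matrix.sub_mulVec, Matrix.smul_mulVec, hSu, Pi.sub_apply, Matrix.mulVec_diagonal,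
      Pi.smul_apply, Pi.smul_apply, smul_eq_mul, smul_eq_mul, hμ, sub_self, Pi.zero_apply]
  have hSd := sub_eq_zero.1 (eq_zero_of_mulVec_eigenvectorBasis hS key)
  have hent : ∀ i j, τ 1 * C i j = Matrix.diagonal ζ i j := by
    intro i j
    have h1 := congrFun (congrFun hSd i) j
    simp only [Matrix.smul_apply, hSdef, Matrix.of_apply, smul_eq_mul] at h1
    rcases eq_or_ne i j with rfl | hij
    · rwa [mul_div_assoc, div_self (hsq i), mul_one] at h1
    · rw [Matrix.diagonal_apply_ne _ hij] at h1 ⊢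
      have := hsq i
      have := hsq j
      field_simp at h1
      simpa [hsq j] using h1
  have hτ1 : τ 1 ≠ 0 := by
    intro h0
    refine h.sum_ζ_sq_pos.ne' (Finset.sum_eq_zero fun i _ => ?_)
    have := hent i i
    rw [h0, zero_mul, Matrix.diagonal_apply_eq] at this
    rw [← this, zero_pow two_ne_zero]
  refine ⟨hτ1, ?_⟩
  ext i j
  have h1 := hent i j
  rcases eq_or_ne i j with rfl | hij
  · rw [Matrix.diagonal_apply_eq] at h1 ⊢
    rw [eq_div_iff hτ1, mul_comm, h1]
  · rw [Matrix.diagonal_apply_ne _ hij] at h1 ⊢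
    exact (mul_eq_zero.1 h1).resolve_left hτ1

/-- If `ω' = -ω²` and `ψ' = ω`, then `exp ψ` is affine. -/
theorem exp_eq_affine {ψ ω : ℝ → ℂ}
    (hψ : ∀ t ∈ Icc (0 : ℝ) 1, HasDerivWithinAt ψ (ω t) (Icc 0 1) t)
    (hω : ∀ t ∈ Icc (0 : ℝ) 1, HasDerivWithinAt ω (-(ω t) ^ 2) (Icc 0 1) t) {t : ℝ}
    (ht : t ∈ Icc (0 : ℝ) 1) :
    Complex.exp (ψ t) =
      Complex.exp (ψ 0) + t * (Complex.exp (ψ 1) - Complex.exp (ψ 0)) := by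
  have h1 : ∀ s ∈ Icc (0 : ℝ) 1, Complex.exp (ψ s) * ω s = Complex.exp (ψ 0) * ω 0 := by
    intro s hs
    refine eq_of_hasDerivWithinAt_zero (f := fun r => Complex.exp (ψ r) * ω r) (fun r hr => ?_) hs
    refine ((hψ r hr).cexp.mul (hω r hr)).congr_deriv ?_
    ring
  have h2 : ∀ s ∈ Icc (0 : ℝ) 1,
      Complex.exp (ψ s) - Complex.exp (ψ 0) = s * (Complex.exp (ψ 0) * ω 0) := by
    intro s hs
    have := sub_eq_of_hasDerivWithinAt_eq (f := fun r => Complex.exp (ψ r))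
      (g := fun r : ℝ => (r : ℂ) * (Complex.exp (ψ 0) * ω 0))
      (fun r hr => (hψ r hr).cexp.congr_deriv (h1 r hr))
      (fun r _ => by
        have := ((hasDerivWithinAt_id r (Icc (0 : ℝ) 1)).ofReal_comp.mul_const
          (Complex.exp (ψ 0) * ω 0))
        exact this.congr_deriv (by simp)) hs
    simpa using this
  have h3 := h2 1 (right_mem_Icc.2 zero_le_one)
  rw [Complex.ofReal_one, one_mul] at h3
  rw [h3, ← h2 t ht]
  ring

theorem ConeData.eqOn_of_isGeodesic (h : ConeData n β σ γ a b ζ)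
    (hQ : IsGeodesic β (Matrix.diagonal a) (Matrix.diagonal b) Q) :
    EqOn Q (coneGeodesic β σ γ a ζ) (Icc 0 1) := by
  have hJ := hQ.joins
  have hn : (n : ℝ) ≠ 0 := Nat.cast_ne_zero.2 h.n_pos.ne'
  have hβ := h.β_ne
  have hγ := h.γ_mem.1.ne'
  have hκ := (sub_pos.2 h.β_lt).ne'
  set s : ℝ → ℝ := fun t => (Q t).det ^ β with hs_def
  set s' : ℝ → ℝ := fun t => β * ((Q t).det ^ β * ((Q t)⁻¹ * velocity Q t).trace) with hs'_def
  have hs0 : ∀ t ∈ Icc (0 : ℝ) 1, s t ≠ 0 := fun t ht =>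
    (Real.rpow_pos_of_pos (hJ.det_pos ht) β).ne'
  have hs : ∀ t ∈ Icc (0 : ℝ) 1, HasDerivWithinAt s (s' t) (Icc 0 1) t := fun t ht =>
    hJ.hasDerivWithinAt_det_rpow ht
  obtain ⟨τ, hτ0, hτ⟩ := exists_primitive (f := fun t => (s t)⁻¹) fun t ht =>
    (hs t ht).continuousWithinAt.inv₀ (hs0 t ht)
  obtain ⟨hτ1, hC⟩ := h.charge_eq_diagonal hQ hτ0 hτ
  have hs'' : ∀ t ∈ Icc (0 : ℝ) 1, HasDerivWithinAt s'
      ((4 * (γ / τ 1) ^ 2 + s' t ^ 2) / (2 * s t)) (Icc 0 1) t := by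
    intro t ht
    refine (hQ.hasDerivWithinAt_deriv_det_rpow h.n_pos hβ h.β_lt ht).congr_deriv ?_
    have : (charge β Q t * charge β Q t).trace =
        4 * (1 / n - β) / β ^ 2 * γ ^ 2 / τ 1 ^ 2 := by
      rw [hQ.charge_eq h.n_pos ht, hC, Matrix.diagonal_mul_diagonal, Matrix.trace_diagonal,
        ← h.sum_ζ_sq, Finset.sum_div]
      exact Finset.sum_congr rfl fun i _ => by ring
    rw [this]
    congr 2
    generalize (1 / n - β : ℝ) = κ at hκ
    field_simp
  set ψ : ℝ → ℂ := fun t =>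
    ⟨1 / 2 * (Real.log (s t) - Real.log (s 0)), γ / τ 1 * τ t⟩ with hψ_def
  set ω : ℝ → ℂ := fun t => ⟨s' t / (2 * s t), γ / τ 1 * (s t)⁻¹⟩ with hω_def
  have hψ : ∀ t ∈ Icc (0 : ℝ) 1, HasDerivWithinAt ψ (ω t) (Icc 0 1) t := by
    intro t ht
    refine (hasDerivWithinAt_complex_mk ((((hs t ht).log (hs0 t ht)).sub_const _).const_mul (1 / 2))
      ((hτ t ht).const_mul _)).congr_deriv ?_
    apply Complex.ext
    · have := hs0 t ht
      simp only [hω_def]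
      field_simp
    · rfl
  have hω : ∀ t ∈ Icc (0 : ℝ) 1, HasDerivWithinAt ω (-(ω t) ^ 2) (Icc 0 1) t := by
    intro t ht
    have h0 := hs0 t ht
    refine (hasDerivWithinAt_complex_mk ((hs'' t ht).div ((hs t ht).const_mul 2)
      (mul_ne_zero two_ne_zero h0)) (((hs t ht).inv h0).const_mul _)).congr_deriv ?_
    apply Complex.ext
    · simp only [hω_def, sq, Complex.neg_re, Complex.mul_re]
      field_simp
      ring
    · simp only [hω_def, sq, Complex.neg_im, Complex.mul_im]
      field_simp
      ring
  have hψ0 : ψ 0 = 0 := by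
    apply Complex.ext <;> simp [hψ_def, hτ0]
  have hψ1 : ψ 1 = ⟨Real.log σ, γ⟩ := by
    have := h.log_det_rpow_sub
    apply Complex.ext
    · simp only [hψ_def, hs_def, hJ.source, hJ.target, this]
      ring
    · simp only [hψ_def]
      field_simp
  have hexp : ∀ t ∈ Icc (0 : ℝ) 1, Complex.exp (ψ t) = coneSegment σ γ t := by
    intro t ht
    have e1 : Complex.exp (ψ 1) = σ * Complex.exp (γ * Complex.I) := by
      rw [hψ1, ← h.log_coneSegment_one, coneSegment_one, Complex.exp_log]
      exact mul_ne_zero (Complex.ofReal_ne_zero.2 h.σ_pos.ne') (Complex.exp_ne_zero _)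
    rw [exp_eq_affine hψ hω ht, e1, hψ0, Complex.exp_zero, coneSegment]
  intro t ht
  rw [coneGeodesic, ← eq_log_coneSegment h.σ_pos h.γ_mem hψ hψ0 hexp ht]
  ext i j
  have hent := eq_mul_exp_of_hasDerivWithinAt (f := fun r => Q r i j)
    (g := fun r => ζ i / τ 1 * τ r + 1 / (n * β) * Real.log (s r))
    (g' := fun r => ζ i / τ 1 * (s r)⁻¹ + ((Q r)⁻¹ * velocity Q r).trace / n)
    (fun r hr => (hJ.hasEntryDeriv hr i j).congr_deriv (by
      have h1 := hJ.velocity_eq_mul (β := β) hr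
      rw [hQ.charge_eq h.n_pos hr, hC, add_mul, Matrix.smul_mul, Matrix.smul_mul, one_mul] at h1
      have h2 := congrFun (congrFun h1 i) j
      rw [Matrix.add_apply, Matrix.smul_apply, Matrix.smul_apply, Matrix.diagonal_mul] at h2
      rw [h2, smul_eq_mul, smul_eq_mul]
      ring))
    (fun r hr => (((hτ r hr).const_mul _).add
      (((hs r hr).log (hs0 r hr)).const_mul _)).congr_deriv (by
        have := hs0 r hr
        simp only [hs'_def, hs_def] at this ⊢
        field_simp)) ht
  simp only [hJ.source, hτ0] at hent
  rw [hent, coneMatrix]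
  rcases eq_or_ne i j with rfl | hij
  · rw [Matrix.diagonal_apply_eq, Matrix.diagonal_apply_eq, coneExponent, add_assoc, Real.exp_add,
      Real.exp_log (h.a_pos i)]
    congr 2
    simp only [hψ_def]
    field_simp
    ring
  · rw [Matrix.diagonal_apply_ne _ hij, Matrix.diagonal_apply_ne _ hij, zero_mul]

end Unique

/-! ### The explicit formulas for diagonal end points -/

section Formulas

variable {n : ℕ} {β σ γ : ℝ} {a b ζ : Fin n → ℝ}

theorem delta_diagonal (c d : Fin n → ℝ) (hc : ∀ i, c i ≠ 0) :
    delta (Matrix.diagonal c) (Matrix.diagonal d) = √(∑ i, Real.log (d i / c i) ^ 2) := by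
  have h : ∀ f : Fin n → ℝ, (∏ i, (Polynomial.X - Polynomial.C (f i))).roots =
      Finset.univ.val.map f := by
    intro f
    rw [← Polynomial.roots_multiset_prod_X_sub_C (Finset.univ.val.map f), Multiset.map_map]
    rfl
  rw [delta, inv_diagonal hc, Matrix.diagonal_mul_diagonal, Matrix.charpoly_diagonal, h,
    Multiset.map_map]
  congr 1
  refine Finset.sum_congr rfl fun i _ => ?_
  rw [Function.comp_apply, inv_mul_eq_div]

theorem log_sigma_diagonal (ha : ∀ i, 0 < a i) (hb : ∀ i, 0 < b i) :
    Real.log (sigma β (Matrix.diagonal a) (Matrix.diagonal b)) =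
      β / 2 * ∑ i, (Real.log (b i) - Real.log (a i)) := by
  rw [sigma, inv_diagonal fun i => (ha i).ne', Matrix.diagonal_mul_diagonal, Matrix.det_diagonal,
    Real.log_rpow (Finset.prod_pos fun i _ => mul_pos (inv_pos.2 (ha i)) (hb i)),
    Real.log_prod fun i _ => (mul_pos (inv_pos.2 (ha i)) (hb i)).ne']
  congr 1
  refine Finset.sum_congr rfl fun i _ => ?_
  rw [Real.log_mul (inv_pos.2 (ha i)).ne' (hb i).ne', Real.log_inv]
  ring

theorem sigma_diagonal_pos (ha : ∀ i, 0 < a i) (hb : ∀ i, 0 < b i) :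
    0 < sigma β (Matrix.diagonal a) (Matrix.diagonal b) := by
  rw [sigma, inv_diagonal fun i => (ha i).ne', Matrix.diagonal_mul_diagonal, Matrix.det_diagonal]
  exact Real.rpow_pos_of_pos (Finset.prod_pos fun i _ => mul_pos (inv_pos.2 (ha i)) (hb i)) _

theorem zeta_diagonal (ha : ∀ i, 0 < a i) (hb : ∀ i, 0 < b i) (i : Fin n) :
    zeta β (Matrix.diagonal a) (Matrix.diagonal b) i = Real.log (b i) - Real.log (a i) -
      2 / (n * β) * Real.log (sigma β (Matrix.diagonal a) (Matrix.diagonal b)) := by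
  have hσ := sigma_diagonal_pos (β := β) ha hb
  rw [zeta, Matrix.diagonal_apply_eq, Matrix.diagonal_apply_eq,
    Real.log_mul (div_pos (hb i) (ha i)).ne' (Real.rpow_pos_of_pos hσ _).ne',
    Real.log_div (hb i).ne' (ha i).ne', Real.log_rpow hσ]
  ring

theorem gammaBeta_diagonal (hβ : β ≠ 0) (ha : ∀ i, 0 < a i) (hb : ∀ i, 0 < b i) :
    gammaBeta β (Matrix.diagonal a) (Matrix.diagonal b) =
      |β| * √(∑ i, zeta β (Matrix.diagonal a) (Matrix.diagonal b) i ^ 2) /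
        (2 * √(1 / (n : ℝ) - β)) := by
  have hA : 0 < ∏ i, a i := Finset.prod_pos fun i _ => ha i
  have hB : 0 < ∏ i, b i := Finset.prod_pos fun i _ => hb i
  have hA' := Real.rpow_pos_of_pos hA (-1 / (n : ℝ))
  have hB' := Real.rpow_pos_of_pos hB (-1 / (n : ℝ))
  rw [gammaBeta, Matrix.det_diagonal, Matrix.det_diagonal, ← Matrix.diagonal_smul,
    ← Matrix.diagonal_smul, delta_diagonal (_ • a) _ fun i => (mul_pos hA' (ha i)).ne']
  congr 3
  refine Finset.sum_congr rfl fun i _ => ?_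
  congr 1
  rw [zeta_diagonal ha hb, log_sigma_diagonal ha hb, Pi.smul_apply, Pi.smul_apply, smul_eq_mul,
    smul_eq_mul, Real.log_div (mul_pos hB' (hb i)).ne' (mul_pos hA' (ha i)).ne',
    Real.log_mul hB'.ne' (hb i).ne', Real.log_mul hA'.ne' (ha i).ne', Real.log_rpow hA,
    Real.log_rpow hB, Real.log_prod fun i _ => (ha i).ne', Real.log_prod fun i _ => (hb i).ne',
    Finset.sum_sub_distrib]
  field_simp
  ring

theorem coneData_diagonal (hβ : β ∈ Iio (0 : ℝ) ∪ Ioo 0 (1 / (n : ℝ)))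
    (ha : ∀ i, 0 < a i) (hb : ∀ i, 0 < b i)
    (hγ : gammaBeta β (Matrix.diagonal a) (Matrix.diagonal b) ∈ Ioo 0 Real.pi) :
    ConeData n β (sigma β (Matrix.diagonal a) (Matrix.diagonal b))
      (gammaBeta β (Matrix.diagonal a) (Matrix.diagonal b)) a b
      (zeta β (Matrix.diagonal a) (Matrix.diagonal b)) := by
  have hβ0 : β ≠ 0 := by
    rcases hβ with h | h
    exacts [h.ne, h.1.ne']
  have hn : 0 < n := by
    -- For `n = 0` the angle `γ` vanishes.
    rcases Nat.eq_zero_or_pos n with rfl | h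
    · have := hγ.1
      rw [gammaBeta_diagonal hβ0 ha hb] at this
      simp at this
    · exact h
  have hn' : (0 : ℝ) < n := Nat.cast_pos.2 hn
  have hβn : β < 1 / n := by
    rcases hβ with h | h
    · exact lt_trans h (one_div_pos.2 hn')
    · exact h.2
  have hκ := sub_pos.2 hβn
  refine ⟨hn, hβ0, hβn, ha, hb, sigma_diagonal_pos ha hb, hγ, ?_, fun i => ?_, ?_⟩
  · simp only [zeta_diagonal ha hb, log_sigma_diagonal ha hb, Finset.sum_sub_distrib]
    simp
    field_simp
    ring
  · rw [zeta_diagonal ha hb]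
    ring
  · rw [gammaBeta_diagonal hβ0 ha hb, div_pow, mul_pow, mul_pow, sq_abs,
      Real.sq_sqrt (Finset.sum_nonneg fun i _ => sq_nonneg _), Real.sq_sqrt hκ.le]
    generalize (1 / n - β : ℝ) = κ at hκ
    field_simp
    ring

theorem arctan2_eq_arg_coneSegment (t : ℝ) :
    arctan2 (t * σ * Real.sin γ) (1 - t + t * σ * Real.cos γ) = (coneSegment σ γ t).arg := by
  rw [arctan2]
  congr 1
  exact Complex.ext coneSegment_re.symm coneSegment_im.symm

/-- The angle at which the segment is seen from its end point is complementary to the angle at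
which it is seen from its starting point. -/
theorem arctan2_eq_sub_arg_coneSegment (hσ : 0 < σ) (hγ : γ ∈ Ioo 0 Real.pi) {t : ℝ}
    (ht : t ∈ Icc (0 : ℝ) 1) :
    arctan2 ((1 - t) * Real.sin γ) ((1 - t) * Real.cos γ + t * σ) =
      γ - (coneSegment σ γ t).arg := by
  set z := coneSegment σ γ t with hz
  have hslit := coneSegment_mem_slitPlane hσ hγ ht
  have hz0 : 0 < ‖z‖ := norm_pos_iff.2 (Complex.slitPlane_ne_zero hslit)
  have h1 : 0 ≤ z.arg := by
    rw [Complex.arg_nonneg_iff, hz, coneSegment_im]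
    exact mul_nonneg (mul_nonneg ht.1 hσ.le) (Real.sin_pos_of_mem_Ioo hγ).le
  have h2 : z.arg < Real.pi :=
    lt_of_le_of_ne (Complex.arg_le_pi z) (Complex.mem_slitPlane_iff_arg.1 hslit).1
  have hmem : γ - z.arg ∈ Ioc (-Real.pi) Real.pi :=
    ⟨by linarith [hγ.1], by linarith [hγ.2]⟩
  rw [arctan2, ← Complex.arg_mul_cos_add_sin_mul_I hz0 hmem]
  have hre : ‖z‖ * Real.cos z.arg = 1 - t + t * σ * Real.cos γ := by
    rw [Complex.norm_mul_cos_arg, hz, coneSegment_re]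
  have him : ‖z‖ * Real.sin z.arg = t * σ * Real.sin γ := by
    rw [Complex.norm_mul_sin_arg, hz, coneSegment_im]
  congr 1
  rw [← Complex.ofReal_cos, ← Complex.ofReal_sin, Real.cos_sub, Real.sin_sub]
  have hcs := Real.sin_sq_add_cos_sq γ
  apply Complex.ext
  · simp only [Complex.mul_re, Complex.add_re, Complex.ofReal_re, Complex.ofReal_im,
      Complex.I_re, Complex.I_im, Complex.mul_im, Complex.add_im]
    linear_combination -(Real.cos γ) * hre - (Real.sin γ) * him - t * σ * hcs
  · simp only [Complex.mul_re, Complex.add_re, Complex.ofReal_re, Complex.ofReal_im,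
      Complex.I_re, Complex.I_im, Complex.mul_im, Complex.add_im]
    linear_combination -(Real.sin γ) * hre + (Real.cos γ) * him

theorem coneGeodesic_eq_lam
    (h : ConeData n β (sigma β (Matrix.diagonal a) (Matrix.diagonal b))
      (gammaBeta β (Matrix.diagonal a) (Matrix.diagonal b)) a b
      (zeta β (Matrix.diagonal a) (Matrix.diagonal b))) {t : ℝ} (ht : t ∈ Icc (0 : ℝ) 1) :
    coneGeodesic β (sigma β (Matrix.diagonal a) (Matrix.diagonal b))
        (gammaBeta β (Matrix.diagonal a) (Matrix.diagonal b)) a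
        (zeta β (Matrix.diagonal a) (Matrix.diagonal b)) t =
      Matrix.diagonal fun i => lam β (Matrix.diagonal a) (Matrix.diagonal b) i t := by
  rw [coneGeodesic, coneMatrix, Matrix.diagonal_eq_diagonal_iff]
  intro i
  simp only [lam, Matrix.diagonal_apply_eq]
  rw [arctan2_eq_arg_coneSegment, arctan2_eq_sub_arg_coneSegment h.σ_pos h.γ_mem ht]
  generalize sigma β (Matrix.diagonal a) (Matrix.diagonal b) = σ at h
  generalize gammaBeta β (Matrix.diagonal a) (Matrix.diagonal b) = γ at h
  generalize zeta β (Matrix.diagonal a) (Matrix.diagonal b) = ζ at h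
  have hσ := h.σ_pos
  have hγ := h.γ_mem.1.ne'
  have hn : (n : ℝ) ≠ 0 := Nat.cast_ne_zero.2 h.n_pos.ne'
  have hβ := h.β_ne
  have hslit := coneSegment_mem_slitPlane hσ h.γ_mem ht
  have hz0 : 0 < ‖coneSegment σ γ t‖ := norm_pos_iff.2 (Complex.slitPlane_ne_zero hslit)
  have hz2 : ‖coneSegment σ γ t‖ ^ 2 =
      (1 - t) * (1 - t + t * σ * Real.cos γ) +
        σ ^ 2 * (t * (t + (1 - t) * σ⁻¹ * Real.cos γ)) := by
    rw [← Complex.normSq_eq_norm_sq, Complex.normSq_apply, coneSegment_re, coneSegment_im]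
    field_simp
    linear_combination t ^ 2 * σ ^ 2 * Real.sin_sq_add_cos_sq γ
  have ha : a i ^ ((n : ℝ) * β) = Real.exp (n * β * Real.log (a i)) := by
    rw [Real.rpow_def_of_pos (h.a_pos i), mul_comm]
  have hb : b i ^ ((n : ℝ) * β) =
      Real.exp (n * β * Real.log (a i)) * σ ^ 2 * Real.exp (n * β * ζ i) := by
    have e : σ ^ 2 = Real.exp (2 * Real.log σ) := by
      rw [two_mul, Real.exp_add, Real.exp_log hσ, sq]
    rw [Real.rpow_def_of_pos (h.b_pos i), h.log_b, e, ← Real.exp_add, ← Real.exp_add]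
    congr 1
    field_simp
  set θ := (coneSegment σ γ t).arg with hθ
  have hE : Real.exp (n * β * ζ i) * Real.exp (-(n * β / γ) * (γ - θ) * ζ i) =
      Real.exp (n * β / γ * θ * ζ i) := by
    rw [← Real.exp_add]
    congr 1
    field_simp
    ring
  have hsum : a i ^ ((n : ℝ) * β) * ((1 - t) * (1 - t + t * σ * Real.cos γ)) *
        Real.exp (n * β / γ * θ * ζ i) +
      b i ^ ((n : ℝ) * β) * (t * (t + (1 - t) * σ⁻¹ * Real.cos γ)) *
        Real.exp (-(n * β / γ) * (γ - θ) * ζ i) =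
      Real.exp (n * β * Real.log (a i)) * ‖coneSegment σ γ t‖ ^ 2 *
        Real.exp (n * β / γ * θ * ζ i) := by
    rw [ha, hb, hz2, ← hE]
    ring
  rw [hsum, coneExponent, Complex.log_re, Complex.log_im, ← hθ]
  have e : ‖coneSegment σ γ t‖ ^ 2 = Real.exp (2 * Real.log ‖coneSegment σ γ t‖) := by
    rw [two_mul, Real.exp_add, Real.exp_log hz0, sq]
  rw [e, ← Real.exp_add, ← Real.exp_add, ← Real.exp_mul]
  congr 1
  field_simp

end Formulas

end PowerGeometry

end

theorem mainTheorem3 {n : ℕ} (β : ℝ) (hβ : β ∈ Set.Iio (0 : ℝ) ∪ Set.Ioo 0 (1 / (n : ℝ)))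
    (DA DB : Matrix (Fin n) (Fin n) ℝ)
    (hA : DA.PosDef) (hA' : DA.IsDiag) (hB : DB.PosDef) (hB' : DB.IsDiag)
    (hγ : PowerGeometry.gammaBeta β DA DB ∈ Set.Ioo 0 Real.pi) :
    PowerGeometry.gammaBeta β DA DB =
        |β| * √(∑ i, PowerGeometry.zeta β DA DB i ^ 2) / (2 * √(1 / (n : ℝ) - β)) ∧
      ∃ P : ℝ → Matrix (Fin n) (Fin n) ℝ,
        PowerGeometry.IsMinimalGeodesic β DA DB P ∧
        PowerGeometry.IsGeodesic β DA DB P ∧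
        (∀ Q, PowerGeometry.IsMinimalGeodesic β DA DB Q → Set.EqOn Q P (Set.Icc 0 1)) ∧
        (∀ Q, PowerGeometry.IsGeodesic β DA DB Q → Set.EqOn Q P (Set.Icc 0 1)) ∧
        ∀ t ∈ Set.Icc (0 : ℝ) 1,
          P t = Matrix.diagonal fun i => PowerGeometry.lam β DA DB i t := by
  obtain ⟨a, rfl⟩ : ∃ a, Matrix.diagonal a = DA := ⟨_, hA'.diagonal_diag⟩
  obtain ⟨b, rfl⟩ : ∃ b, Matrix.diagonal b = DB := ⟨_, hB'.diagonal_diag⟩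
  have ha := Matrix.posDef_diagonal_iff.1 hA
  have hb := Matrix.posDef_diagonal_iff.1 hB
  have h := PowerGeometry.coneData_diagonal hβ ha hb hγ
  exact ⟨PowerGeometry.gammaBeta_diagonal h.β_ne ha hb, _, h.isMinimalGeodesic_coneGeodesic,
    h.isGeodesic_coneGeodesic, fun Q hQ => h.eqOn_of_isMinimalGeodesic hQ,
    fun Q hQ => h.eqOn_of_isGeodesic hQ, fun t ht => PowerGeometry.coneGeodesic_eq_lam h ht⟩
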